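/- Write $\mathcal U^2=(0,1)^2$ for the open unit square, $\lambda$ for Lebesgue measure on it, and "uniform" for the law $\lambda$. A basic box in $\mathbb R^2$ is the solution set of finitely many inequalities $b\cdot x\le c$ or $b\cdot x>c$, each $b\in\mathbb R^2$ having exactly one nonzero coordinate. A finite, rooted, binary tree-structured partition of $\mathcal U^2$ is the family of boxes attached to the terminal nodes of a finite rooted binary tree in which the root carries $\mathcal U^2$, every node carries a nonempty basic box, and the box of each parent is the disjoint union of the boxes of its two children. For such a partition $Q$, let $\|Q\|$ be the maximum of the diameters of its members, and let $B_Q(x)$ be the member containing $x$. **Corollary 1.4.** For every $\varepsilon>0$ there are a sequence $(Q^{(N)})_{N\ge 0}$ of finite, rooted, binary tree-structured partitions of $\mathcal U^2$, all of whose members have positive Lebesgue measure, with $\|Q^{(N)}\|\to0$; a probability law $\nu$ of a pair $(X,Y)\in\mathcal U^2\times[0,\infty)$ with $X$ uniform and $E|Y|<\infty$; and a Borel version $g\ge0$ of $x\mapsto E(Y\mid X=x)$ with $\int_{\mathcal U^2} g\,d\lambda>0$, such that (1)–(3) below hold. 1. (Regression.) Let $(X,Y),(X_1,Y_1),(X_2,Y_2),\dots$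 be i.i.d. with law $\nu$ on any probability space. Put $h_N(x)=E\big(Y\mathbf 1_B(X)\big)/P(X\in B)$ with $B=B_{Q^{(N)}}(x)$, and let $\hat h_N(x)$ be the average of those $Y_n$, $1\le n\le N$, for which $X_n\in B$ (and $0$ if there are none). Then $$P\big(\hat h_N(X)-h_N(X)\to0\big)=1,\qquad P\big(h_N(X)-g(X)\to0\big)=0 .$$ 2. (Bayes rule.) Let $h=g/\int g\,d\lambda$. Consider the two-class problem in which $Y=1$ or $2$ with probability $1/2$ each, $X$ has density $h$ on $\mathcal U^2$ given $Y=1$, and $X$ is uniform on $\mathcal U^2$ given $Y=2$. The rule $d_B$ with $d_B(x)=1$ if $h(x)>1$ and $d_B(x)=2$ otherwise is a Bayes rule: it minimises the expected loss $P(d(X)\ne Y)$ among all Borel functions $d$ with values in $\{1,2\}$. 3. (Classification.) Let $(X,Y),(X_1,Y_1),(X_2,Y_2),\dots$ be i.i.d. with the law of the two-class problem in (2), on any probability space. Let $d_N(x)=1$ if $$\#\{n\le N: X_n\in B_{Q^{(N)}}(x),\,Y_n=1\}>\#\{n\le N: X_n\in B_{Q^{(N)}}(x),\,Y_n=2\},$$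 and $d_N(x)=2$ otherwise. Then the rules $d_N$ are Bayes-risk consistent, that is, $P(d_N(X)\ne Y)\to P(d_B(X)\ne Y)$, and yet $$P\big(d_N(X)\to d_B(X)\big)<\varepsilon .$$ -/

import Mathlib

open MeasureTheory ProbabilityTheory Filter Topology

noncomputable section

namespace TreeRules

/-- `d`-dimensional Euclidean space. -/
abbrev E (d : ℕ) : Type := EuclideanSpace ℝ (Fin d)

/-- The open unit cube of `E d`. -/
def cube (d : ℕ) : Set (E d) := {x | ∀ i, 0 < x i ∧ x i < 1}

/-- The uniform distribution on the open unit cube (which has Lebesgue measure one). -/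
def uniform (d : ℕ) : Measure (E d) := volume.restrict (cube d)

/-- A basic box: the solution set of a finite system of inequalities `b · x ≤ c` (the pairs
`(b, c)` in `S`) and `b · x > c` (the pairs in `T`), where each `b` has exactly one nonzero
coordinate. -/
def IsBasicBox {d : ℕ} (B : Set (E d)) : Prop :=
  ∃ S T : Finset (E d × ℝ),
    (∀ p ∈ S, ∃! i, p.1 i ≠ 0) ∧ (∀ p ∈ T, ∃! i, p.1 i ≠ 0) ∧
    B = {x | (∀ p ∈ S, inner ℝ p.1 x ≤ p.2) ∧ (∀ p ∈ T, p.2 < inner ℝ p.1 x)}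

/-- `IsTreePartition B Q`: the family `Q` of nonempty basic boxes is a finite, rooted, binary
tree-structured partition of the basic box `B`. The root of the tree carries `B`, every parent
carries a basic box which is the disjoint union of the boxes carried by its left and its right
child, and `Q` is the family of the boxes carried by the terminal nodes. -/
inductive IsTreePartition {d : ℕ} : Set (E d) → Set (Set (E d)) → Prop
  | terminal (B : Set (E d)) (hB : IsBasicBox B) (hne : B.Nonempty) : IsTreePartition B {B}
  | split (B B₁ B₂ : Set (E d)) (Q₁ Q₂ : Set (Set (E d))) (hB : IsBasicBox B)
      (hdisj : Disjoint B₁ B₂) (hunion : B₁ ∪ B₂ = B)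
      (h₁ : IsTreePartition B₁ Q₁) (h₂ : IsTreePartition B₂ Q₂) : IsTreePartition B (Q₁ ∪ Q₂)

/-- The norm of a finite partition: the maximum of the diameters of its members. -/
def partitionNorm {d : ℕ} (Q : Set (Set (E d))) : ℝ := sSup (Metric.diam '' Q)

/-- The member of the partition `Q` that contains `x` (the empty set if there is none). -/
def cell {d : ℕ} (Q : Set (Set (E d))) (x : E d) : Set (E d) := ⋃₀ {B ∈ Q | x ∈ B}

/-- `Z 0, Z 1, Z 2, …` are independent random vectors on `(Ω, P)` with the common law `ν`.
Throughout, `Z 0 = (X, Y)` is the test case and `Z n = (X_n, Y_n)`, `n ≥ 1`, is the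
learning sample. -/
structure IsIID {Ω S : Type*} [MeasurableSpace Ω] [MeasurableSpace S] (P : Measure Ω)
    (ν : Measure S) (Z : ℕ → Ω → S) : Prop where
  measurable : ∀ n, Measurable (Z n)
  indep : iIndepFun Z P
  law : ∀ n, P.map (Z n) = ν

/-! ### Regression -/

/-- `h_N(x) = E(Y 1_B(X)) / P(X ∈ B)`, where `(X, Y)` has law `ν` and `B` is the cell of `x`. -/
def cellMean {d : ℕ} (ν : Measure (E d × ℝ)) (Q : Set (Set (E d))) (x : E d) : ℝ :=
  (∫ z in {z : E d × ℝ | z.1 ∈ cell Q x}, z.2 ∂ν) / ν.real {z : E d × ℝ | z.1 ∈ cell Q x}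

open Classical in
/-- The empirical version of `cellMean`: the average of those `Y_n`, `1 ≤ n ≤ N`, for which `X_n`
lies in the cell of `x`, and zero if there is no such `n`. -/
def empiricalCellMean {d : ℕ} (Q : Set (Set (E d))) (N : ℕ) (z : ℕ → E d × ℝ) (x : E d) : ℝ :=
  if 0 < (∑ n ∈ Finset.Icc 1 N, if (z n).1 ∈ cell Q x then (1 : ℝ) else 0) / N then
    ((∑ n ∈ Finset.Icc 1 N, if (z n).1 ∈ cell Q x then (z n).2 else 0) / N) /
      ((∑ n ∈ Finset.Icc 1 N, if (z n).1 ∈ cell Q x then (1 : ℝ) else 0) / N)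
  else 0

/-- `ν` is the law of a pair `(X, Y)` with `X` uniform on the unit cube, `Y ≥ 0`, `E|Y| < ∞`, and
the Borel function `g ≥ 0` is a version of the regression function `x ↦ E(Y | X = x)`. -/
structure IsRegressionModel {d : ℕ} (ν : Measure (E d × ℝ)) (g : E d → ℝ) : Prop where
  isProbabilityMeasure : IsProbabilityMeasure ν
  uniform_fst : ν.map Prod.fst = uniform d
  nonneg : ∀ᵐ z ∂ν, 0 ≤ z.2
  integrable : Integrable (fun z : E d × ℝ => z.2) ν
  measurable_reg : Measurable g
  nonneg_reg : ∀ x, 0 ≤ g x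
  condExp_eq : (fun z : E d × ℝ => g z.1) =ᵐ[ν]
    ν[fun z : E d × ℝ => z.2 | MeasurableSpace.comap Prod.fst (inferInstance : MeasurableSpace (E d))]

/-! ### Two-class classification -/

/-- `g` scaled to have integral one over the unit cube. -/
def scaledDensity {d : ℕ} (g : E d → ℝ) (x : E d) : ℝ := g x / ∫ y, g y ∂(uniform d)

/-- The law of `(X, Y)` in the two-class problem: `Y` is `1` or `2` with probability `1/2` each;
given `Y = 1`, `X` has density `h` on the unit cube; given `Y = 2`, `X` is uniform there. -/
def classLaw {d : ℕ} (h : E d → ℝ) : Measure (E d × ℕ) :=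
  (2⁻¹ : ENNReal) • ((uniform d).withDensity fun x => ENNReal.ofReal (h x)).prod (Measure.dirac 1) +
  (2⁻¹ : ENNReal) • (uniform d).prod (Measure.dirac 2)

open Classical in
/-- The tree-structured majority vote rule: `x` is put into class `1` if strictly more of the
sample points `X_1, …, X_N` in the cell of `x` have label `1` than label `2`, and otherwise into
class `2`. -/
def majorityVote {d : ℕ} (Q : Set (Set (E d))) (N : ℕ) (z : ℕ → E d × ℕ) (x : E d) : ℕ :=
  if ((Finset.Icc 1 N).filter fun n => (z n).1 ∈ cell Q x ∧ (z n).2 = 2).card <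
      ((Finset.Icc 1 N).filter fun n => (z n).1 ∈ cell Q x ∧ (z n).2 = 1).card
  then 1 else 2

open Classical in
/-- The rule `d_B(x) = 1` if `h(x) > 1` and `d_B(x) = 2` otherwise. -/
def bayesRule {d : ℕ} (h : E d → ℝ) (x : E d) : ℕ := if 1 < h x then 1 else 2

/-- The expected loss `P(δ(X) ≠ Y)` of a rule `δ` when `(X, Y)` has law `ν`. -/
def risk {d : ℕ} (ν : Measure (E d × ℕ)) (δ : E d → ℕ) : ℝ := ν.real {z | δ z.1 ≠ z.2}

/-- A (non-random) classification rule: a Borel function with values in `{1, 2}`. -/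
def IsRule {d : ℕ} (δ : E d → ℕ) : Prop := Measurable δ ∧ ∀ x, δ x = 1 ∨ δ x = 2

/-- A Bayes rule: a rule whose expected loss is the smallest among all rules. -/
def IsBayesRule {d : ℕ} (ν : Measure (E d × ℕ)) (δ : E d → ℕ) : Prop :=
  IsRule δ ∧ ∀ δ' : E d → ℕ, IsRule δ' → risk ν δ ≤ risk ν δ'

end TreeRules

end

noncomputable section

namespace TreeRules

/-! ### Basic boxes and tree-structured partitions -/

/-! Averages over rectangles of unbounded eccentricity need not converge almost everywhere for an
integrable function, although along grids of vanishing mesh they always converge in measure. The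
first fact destroys pointwise convergence, the second saves the risk.

The divergent function is built from hyperbolic crosses. On a fine square grid, a cell lies in `m`
aligned rectangles of `2 ^ m` cells each, of shapes from thin to flat, and their union has at least
`m * 2 ^ (m - 1)` cells (`card_sharesRectangle`). This extra factor `m` lets a few well-chosen cells
meet the crosses of nearly all points (`exists_selection`). Mass put on those cells has small
integral, yet gives almost every point a rectangle with large average (`exists_large_averages`).
Summing over levels and applying Borel–Cantelli gives `F` of integral at most `δ` whose averages are
unbounded almost everywhere along one sequence of grids (`exists_divergent_grids`).

Take `g = 1 + F` and `Y = g X`. Since `F` is `0` or at least `1`, and `1 < ∫ g ≤ 1 + δ`, for small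
`δ` the density `h = g / ∫ g` stays away from `1`: the Bayes rule is `2` where `g = 1` and `1` where
`g ≥ 2`. Convergence in measure of the averages (`tendsto_measure_gridAverage_sub`) then gives risk
consistency, while unbounded averages force vote `1` infinitely often almost everywhere. So the
votes can converge to the Bayes rule only on `{g ≥ 2}`, whose probability is of order `δ`.

Sampling error is removed by letting the grids advance slowly: grid `k` is first used at a time
after which the law of large numbers holds uniformly over its finitely many cells, off a set of
summable probability (`exists_uniform_times_finset`, `exists_slow_schedule`). -/

theorem isBasicBox_univ {d : ℕ} : IsBasicBox (Set.univ : Set (E d)) :=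
  ⟨∅, ∅, by simp, by simp, by simp⟩

theorem IsBasicBox.inter_inner_le {d : ℕ} {B : Set (E d)} (hB : IsBasicBox B) {v : E d}
    (hv : ∃! i, v i ≠ 0) (c : ℝ) : IsBasicBox (B ∩ {x | inner ℝ v x ≤ c}) := by
  classical
  obtain ⟨S, T, hS, hT, rfl⟩ := hB
  refine ⟨insert (v, c) S, T, ?_, hT, ?_⟩
  · intro p hp
    rcases Finset.mem_insert.1 hp with rfl | hp
    exacts [hv, hS p hp]
  · ext x
    simp only [Set.mem_inter_iff, Set.mem_ofPred_eq, Finset.forall_mem_insert]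
    tauto

theorem IsBasicBox.inter_lt_inner {d : ℕ} {B : Set (E d)} (hB : IsBasicBox B) {v : E d}
    (hv : ∃! i, v i ≠ 0) (c : ℝ) : IsBasicBox (B ∩ {x | c < inner ℝ v x}) := by
  classical
  obtain ⟨S, T, hS, hT, rfl⟩ := hB
  refine ⟨S, insert (v, c) T, hS, ?_, ?_⟩
  · intro p hp
    rcases Finset.mem_insert.1 hp with rfl | hp
    exacts [hv, hT p hp]
  · ext x
    simp only [Set.mem_inter_iff, Set.mem_ofPred_eq, Finset.forall_mem_insert]
    tauto

theorem existsUnique_single_ne_zero {d : ℕ} (i : Fin d) {a : ℝ} (ha : a ≠ 0) :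
    ∃! j, (EuclideanSpace.single i a : E d) j ≠ 0 := by
  refine ⟨i, by simpa using ha, fun j hj => ?_⟩
  by_contra h
  simp [h] at hj

theorem IsBasicBox.inter_coord_lt {d : ℕ} {B : Set (E d)} (hB : IsBasicBox B) (i : Fin d)
    (c : ℝ) : IsBasicBox (B ∩ {x | x i < c}) := by
  have := hB.inter_lt_inner (existsUnique_single_ne_zero i (a := (-1 : ℝ)) (by norm_num)) (-c)
  simpa [EuclideanSpace.inner_single_left] using this

theorem IsBasicBox.inter_lt_coord {d : ℕ} {B : Set (E d)} (hB : IsBasicBox B) (i : Fin d)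
    (c : ℝ) : IsBasicBox (B ∩ {x | c < x i}) := by
  have := hB.inter_lt_inner (existsUnique_single_ne_zero i (a := (1 : ℝ)) (by norm_num)) c
  simpa [EuclideanSpace.inner_single_left] using this

theorem IsBasicBox.inter_le_coord {d : ℕ} {B : Set (E d)} (hB : IsBasicBox B) (i : Fin d)
    (c : ℝ) : IsBasicBox (B ∩ {x | c ≤ x i}) := by
  have := hB.inter_inner_le (existsUnique_single_ne_zero i (a := (-1 : ℝ)) (by norm_num)) (-c)
  simpa [EuclideanSpace.inner_single_left] using this

theorem isBasicBox_cube_two : IsBasicBox (cube 2) := by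
  have := (((isBasicBox_univ (d := 2)).inter_lt_coord 0 0).inter_coord_lt 0 1).inter_lt_coord 1 0
    |>.inter_coord_lt 1 1
  convert this using 1
  ext x
  simp [cube, Fin.forall_fin_two, and_assoc]

theorem isBasicBox_inter_floor_lt {d : ℕ} {B : Set (E d)} (hB : IsBasicBox B) (i : Fin d)
    {n t : ℕ} (hn : 0 < n) (ht : t ≠ 0) :
    IsBasicBox (B ∩ {x | ⌊(n : ℝ) * x i⌋₊ < t}) := by
  convert hB.inter_coord_lt i ((t : ℝ) / n) using 4 with x
  have : (0 : ℝ) < n := by exact_mod_cast hn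
  rw [Nat.floor_lt' ht, lt_div_iff₀ this, mul_comm]

theorem isBasicBox_inter_floor_eq {d : ℕ} {B : Set (E d)} (hB : IsBasicBox B) (i : Fin d)
    {n : ℕ} (hn : 0 < n) (t : ℕ) :
    IsBasicBox (B ∩ {x | ⌊(n : ℝ) * x i⌋₊ = t}) := by
  have h1 := isBasicBox_inter_floor_lt hB i hn (Nat.succ_ne_zero t)
  -- The natural-number floor sends negative numbers to `0`, so slab `0` is unbounded below and
  -- needs no lower inequality.
  rcases Nat.eq_zero_or_pos t with rfl | ht
  · convert h1 using 4 with x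
    omega
  · convert h1.inter_le_coord i ((t : ℝ) / n) using 1
    have : (0 : ℝ) < n := by exact_mod_cast hn
    ext x
    simp only [Set.mem_inter_iff, Set.mem_ofPred_eq, and_assoc]
    rw [div_le_iff₀ this, mul_comm (x i), ← Nat.le_floor_iff' ht.ne']
    refine and_congr_right fun _ => ?_
    omega

/-- Refining every terminal node of a tree-structured partition. -/
theorem IsTreePartition.refine {d : ℕ} {B : Set (E d)} {Q : Set (Set (E d))}
    (h : IsTreePartition B Q) (R : Set (E d) → Set (Set (E d)))
    (hR : ∀ C ∈ Q, IsTreePartition C (R C)) : IsTreePartition B (⋃ C ∈ Q, R C) := by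
  induction h with
  | terminal B hB hne => simpa using hR B rfl
  | split B B₁ B₂ Q₁ Q₂ hB hdisj hunion h₁ h₂ ih₁ ih₂ =>
    rw [Set.biUnion_union]
    exact .split B B₁ B₂ _ _ hB hdisj hunion (ih₁ fun C hC => hR C (Or.inl hC))
      (ih₂ fun C hC => hR C (Or.inr hC))

/-- The tree peels off the last slab at each split. Nonemptiness of the slabs is required because
terminal nodes must be nonempty. -/
theorem isTreePartition_slabs {d : ℕ} {B : Set (E d)} (hB : IsBasicBox B) (i : Fin d)
    {n : ℕ} (hn : 0 < n) (t : ℕ)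
    (hne : ∀ a ≤ t, (B ∩ {x | ⌊(n : ℝ) * x i⌋₊ = a}).Nonempty) :
    IsTreePartition (B ∩ {x | ⌊(n : ℝ) * x i⌋₊ < t + 1})
      ((fun a : ℕ => B ∩ {x | ⌊(n : ℝ) * x i⌋₊ = a}) '' Set.Iio (t + 1)) := by
  induction t with
  | zero =>
    have h0 : IsTreePartition _ _ :=
      .terminal _ (isBasicBox_inter_floor_eq hB i hn 0) (hne 0 le_rfl)
    convert h0 using 1
    · ext x
      simp only [Set.mem_inter_iff, Set.mem_ofPred_eq]
      refine and_congr_right fun _ => ?_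
      omega
    · ext C
      simp [eq_comm]
  | succ t ih =>
    have key := IsTreePartition.split (B ∩ {x | ⌊(n : ℝ) * x i⌋₊ < t + 1 + 1}) _
      (B ∩ {x | ⌊(n : ℝ) * x i⌋₊ = t + 1}) _ _
      (isBasicBox_inter_floor_lt hB i hn (Nat.succ_ne_zero _)) ?_ ?_
      (ih fun a ha => hne a (by omega))
      (.terminal _ (isBasicBox_inter_floor_eq hB i hn (t + 1)) (hne (t + 1) le_rfl))
    · convert key using 1
      have : Set.Iio (t + 1 + 1) = Set.Iio (t + 1) ∪ {t + 1} := by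
        ext a
        simp only [Set.mem_Iio, Set.mem_union, Set.mem_singleton_iff]
        omega
      rw [this, Set.image_union, Set.image_singleton]
    · rw [Set.disjoint_left]
      rintro x ⟨_, hx⟩ ⟨_, hx'⟩
      simp only [Set.mem_ofPred_eq] at hx hx'
      omega
    · ext x
      simp only [Set.mem_inter_iff, Set.mem_ofPred_eq, Set.mem_union, ← and_or_left]
      refine and_congr_right fun _ => ?_
      omega

/-! ### Grids on the unit square -/

/-- The position of `x` in the grid with `s.1` columns and `s.2` rows. -/
def gridIndex (s : ℕ × ℕ) (x : E 2) : ℕ × ℕ := (⌊(s.1 : ℝ) * x 0⌋₊, ⌊(s.2 : ℝ) * x 1⌋₊)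

/-- The rectangle at position `a` in the grid with `s.1` columns and `s.2` rows. -/
def gridCell (s a : ℕ × ℕ) : Set (E 2) := {x | x ∈ cube 2 ∧ gridIndex s x = a}

/-- The positions in the grid with `s.1` columns and `s.2` rows. -/
def gridPositions (s : ℕ × ℕ) : Finset (ℕ × ℕ) := Finset.range s.1 ×ˢ Finset.range s.2

/-- The partition of the unit square into `s.1 * s.2` congruent rectangles. -/
def gridPartition (s : ℕ × ℕ) : Set (Set (E 2)) := gridCell s '' gridPositions s

theorem measurableSet_cube {d : ℕ} : MeasurableSet (cube d) := by
  have : cube d = ⋂ i, {x : E d | 0 < x i ∧ x i < 1} := by ext; simp [cube]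
  rw [this]
  exact MeasurableSet.iInter fun i => by measurability

@[fun_prop]
theorem measurable_gridIndex (s : ℕ × ℕ) : Measurable (gridIndex s) := by
  unfold gridIndex
  exact (Nat.measurable_floor.comp (by fun_prop)).prodMk (Nat.measurable_floor.comp (by fun_prop))

theorem measurableSet_gridCell (s a : ℕ × ℕ) : MeasurableSet (gridCell s a) :=
  measurableSet_cube.inter (measurable_gridIndex s (measurableSet_singleton a))

theorem gridCell_subset_cube (s a : ℕ × ℕ) : gridCell s a ⊆ cube 2 := fun _ hx => hx.1

theorem gridIndex_mem_gridPositions {s : ℕ × ℕ} (hs : 0 < s.1 ∧ 0 < s.2) {x : E 2}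
    (hx : x ∈ cube 2) : gridIndex s x ∈ gridPositions s := by
  have h1 : (0 : ℝ) < s.1 := by exact_mod_cast hs.1
  have h2 : (0 : ℝ) < s.2 := by exact_mod_cast hs.2
  simp only [gridPositions, gridIndex, Finset.mem_product, Finset.mem_range]
  rw [Nat.floor_lt' hs.1.ne', Nat.floor_lt' hs.2.ne']
  exact ⟨by nlinarith [hx 0], by nlinarith [hx 1]⟩

theorem floor_mul_eq_iff {n : ℕ} (hn : 0 < n) {a : ℕ} {y : ℝ} (hy : 0 ≤ y) :
    ⌊(n : ℝ) * y⌋₊ = a ↔ (a : ℝ) / n ≤ y ∧ y < ((a : ℝ) + 1) / n := by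
  have h : (0 : ℝ) < n := by exact_mod_cast hn
  rw [Nat.floor_eq_iff (by positivity), div_le_iff₀ h, lt_div_iff₀ h, mul_comm]

/-- A cell on the left or lower edge of the square is not half-open, since the cube is open; hence
the sandwich between an open and a half-open box of equal volume. -/
theorem volume_gridCell {s a : ℕ × ℕ} (ha : a ∈ gridPositions s) :
    volume (gridCell s a) = ENNReal.ofReal ((s.1 * s.2 : ℝ)⁻¹) := by
  simp only [gridPositions, Finset.mem_product, Finset.mem_range] at ha
  have hs1 : 0 < s.1 := by omega
  have hs2 : 0 < s.2 := by omega
  have h1 : (0 : ℝ) < s.1 := by exact_mod_cast hs1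
  have h2 : (0 : ℝ) < s.2 := by exact_mod_cast hs2
  have ha1 : (a.1 : ℝ) + 1 ≤ s.1 := by exact_mod_cast ha.1
  have ha2 : (a.2 : ℝ) + 1 ≤ s.2 := by exact_mod_cast ha.2
  let l : Fin 2 → ℝ := ![(a.1 : ℝ) / s.1, (a.2 : ℝ) / s.2]
  let r : Fin 2 → ℝ := ![((a.1 : ℝ) + 1) / s.1, ((a.2 : ℝ) + 1) / s.2]
  have hprod : ∏ i, ENNReal.ofReal (r i - l i) = ENNReal.ofReal ((s.1 * s.2 : ℝ)⁻¹) := by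
    rw [Fin.prod_univ_two, ← ENNReal.ofReal_mul]
    · congr 1
      simp only [l, r, Matrix.cons_val_zero, Matrix.cons_val_one]
      field_simp
      ring
    · simp only [l, r, Matrix.cons_val_zero]
      rw [← sub_div, add_sub_cancel_left]
      positivity
  have hmp := EuclideanSpace.volume_preserving_symm_measurableEquiv_toLp (Fin 2)
  have hcell : ∀ x : E 2, x ∈ cube 2 → (x ∈ gridCell s a ↔ ∀ i, l i ≤ x i ∧ x i < r i) := by
    intro x hx
    simp only [gridCell, gridIndex, Set.mem_ofPred_eq, hx, true_and, Fin.forall_fin_two, Prod.ext_iff]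
    rw [floor_mul_eq_iff hs1 (hx 0).1.le, floor_mul_eq_iff hs2 (hx 1).1.le]
    simp [l, r]
  apply le_antisymm
  · rw [← hprod, ← Real.volume_pi_Ico, ← hmp.measure_preimage_equiv]
    refine measure_mono fun x hx => ?_
    simpa [Set.mem_pi] using (hcell x hx.1).1 hx
  · rw [← hprod, ← Real.volume_pi_Ioo, ← hmp.measure_preimage_equiv]
    refine measure_mono fun x hx => ?_
    have hx' : ∀ i, l i < x i ∧ x i < r i := by simpa [Set.mem_pi] using hx
    have hc : x ∈ cube 2 := by
      intro i
      have hl : 0 ≤ l i := by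
        fin_cases i <;> simp [l] <;> positivity
      have hr : r i ≤ 1 := by
        fin_cases i <;> simp only [r, Fin.zero_eta, Fin.mk_one, Matrix.cons_val_zero, Matrix.cons_val_one]
        · rwa [div_le_one h1]
        · rwa [div_le_one h2]
      exact ⟨by linarith [hx' i], by linarith [hx' i]⟩
    exact (hcell x hc).2 fun i => ⟨(hx' i).1.le, (hx' i).2⟩

theorem volume_gridCell_pos {s a : ℕ × ℕ} (ha : a ∈ gridPositions s) :
    0 < volume (gridCell s a) := by
  rw [volume_gridCell ha, ENNReal.ofReal_pos]
  simp only [gridPositions, Finset.mem_product, Finset.mem_range] at ha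
  have h1 : (0 : ℝ) < s.1 := by exact_mod_cast (by omega : 0 < s.1)
  have h2 : (0 : ℝ) < s.2 := by exact_mod_cast (by omega : 0 < s.2)
  positivity

theorem gridCell_nonempty {s a : ℕ × ℕ} (ha : a ∈ gridPositions s) : (gridCell s a).Nonempty :=
  nonempty_of_measure_ne_zero (volume_gridCell_pos ha).ne'

theorem uniform_gridCell {s a : ℕ × ℕ} (ha : a ∈ gridPositions s) :
    uniform 2 (gridCell s a) = ENNReal.ofReal ((s.1 * s.2 : ℝ)⁻¹) := by
  rw [uniform, Measure.restrict_apply (measurableSet_gridCell s a),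
    Set.inter_eq_left.2 (gridCell_subset_cube s a), volume_gridCell ha]

instance : IsProbabilityMeasure (uniform 2) := by
  constructor
  have h : gridCell (1, 1) (0, 0) = cube 2 := by
    refine subset_antisymm (gridCell_subset_cube _ _) fun x hx => ⟨hx, ?_⟩
    simpa [gridPositions] using gridIndex_mem_gridPositions (s := (1, 1)) (by simp) hx
  rw [uniform, Measure.restrict_apply_univ, ← h, volume_gridCell (by simp [gridPositions])]
  simp

theorem ae_mem_cube : ∀ᵐ x ∂(uniform 2), x ∈ cube 2 := ae_restrict_mem measurableSet_cube

/-- Cut the square into columns, then refine every column into rows. -/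
theorem isTreePartition_gridPartition {s : ℕ × ℕ} (hs : 0 < s.1 ∧ 0 < s.2) :
    IsTreePartition (cube 2) (gridPartition s) := by
  obtain ⟨⟨m, hm⟩, ⟨n, hn⟩⟩ : (∃ m, s.1 = m + 1) ∧ ∃ n, s.2 = n + 1 :=
    ⟨Nat.exists_eq_succ_of_ne_zero hs.1.ne', Nat.exists_eq_succ_of_ne_zero hs.2.ne'⟩
  let slab : ℕ → Set (E 2) := fun a => cube 2 ∩ {x | ⌊(s.1 : ℝ) * x 0⌋₊ = a}
  have hcell : ∀ a b, slab a ∩ {x | ⌊(s.2 : ℝ) * x 1⌋₊ = b} = gridCell s (a, b) := by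
    intro a b
    ext x
    simp only [slab, gridCell, gridIndex, Set.mem_inter_iff, Set.mem_ofPred_eq, Prod.ext_iff,
      and_assoc]
  have hpos : ∀ a b, a ≤ m → b ≤ n → (a, b) ∈ gridPositions s := by
    intro a b ha hb
    simp only [gridPositions, Finset.mem_product, Finset.mem_range]
    omega
  have h1 : IsTreePartition (cube 2) (slab '' Set.Iio (m + 1)) := by
    have := isTreePartition_slabs isBasicBox_cube_two 0 hs.1 m fun a ha => by
      obtain ⟨x, hx⟩ := gridCell_nonempty (hpos a 0 ha (Nat.zero_le _))
      rw [← hcell] at hx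
      exact ⟨x, hx.1⟩
    convert this using 1
    refine (Set.inter_eq_left.2 fun x hx => ?_).symm
    have := gridIndex_mem_gridPositions hs hx
    simp only [gridPositions, gridIndex, Finset.mem_product, Finset.mem_range] at this
    exact hm ▸ this.1
  let R : Set (E 2) → Set (Set (E 2)) := fun C =>
    (fun b : ℕ => C ∩ {x | ⌊(s.2 : ℝ) * x 1⌋₊ = b}) '' Set.Iio (n + 1)
  have h2 : ∀ C ∈ slab '' Set.Iio (m + 1), IsTreePartition C (R C) := by
    rintro _ ⟨a, ha, rfl⟩
    have hbox : IsBasicBox (slab a) := isBasicBox_inter_floor_eq isBasicBox_cube_two 0 hs.1 a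
    have := isTreePartition_slabs hbox 1 hs.2 n fun b hb => by
      rw [hcell]
      exact gridCell_nonempty (hpos a b (Nat.lt_succ_iff.1 ha) hb)
    convert this using 1
    refine (Set.inter_eq_left.2 fun x hx => ?_).symm
    have := gridIndex_mem_gridPositions hs hx.1
    simp only [gridPositions, gridIndex, Finset.mem_product, Finset.mem_range] at this
    exact hn ▸ this.2
  convert h1.refine R h2 using 1
  ext C
  have hset : (gridPositions s : Set (ℕ × ℕ)) = Set.Iio (m + 1) ×ˢ Set.Iio (n + 1) := by
    rw [← hm, ← hn, gridPositions, Finset.coe_product, Finset.coe_range, Finset.coe_range]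
  simp only [gridPartition, hset, R, Set.mem_image, Set.mem_iUnion, Set.mem_prod, Set.mem_Iio,
    Prod.exists, exists_prop]
  constructor
  · rintro ⟨a, b, ⟨ha, hb⟩, rfl⟩
    exact ⟨slab a, ⟨a, ha, rfl⟩, b, hb, hcell a b⟩
  · rintro ⟨_, ⟨a, ha, rfl⟩, b, hb, rfl⟩
    exact ⟨a, b, ⟨ha, hb⟩, (hcell a b).symm⟩

theorem dist_le_of_mem_gridCell {s a : ℕ × ℕ} (hs : 0 < s.1 ∧ 0 < s.2) {x y : E 2}
    (hx : x ∈ gridCell s a) (hy : y ∈ gridCell s a) :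
    dist x y ≤ (s.1 : ℝ)⁻¹ + (s.2 : ℝ)⁻¹ := by
  have h1 : (0 : ℝ) < s.1 := by exact_mod_cast hs.1
  have h2 : (0 : ℝ) < s.2 := by exact_mod_cast hs.2
  have key : ∀ {n : ℕ}, 0 < n → ∀ {u v : ℝ}, 0 ≤ u → 0 ≤ v →
      ⌊(n : ℝ) * u⌋₊ = ⌊(n : ℝ) * v⌋₊ → |u - v| ≤ (n : ℝ)⁻¹ := by
    intro n hn u v hu hv h
    obtain ⟨a1, a2⟩ := (floor_mul_eq_iff hn hu).1 h
    obtain ⟨b1, b2⟩ := (floor_mul_eq_iff hn hv).1 rfl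
    rw [add_div, one_div] at a2 b2
    rw [abs_le]
    constructor <;> linarith
  have hxy := hx.2.trans hy.2.symm
  simp only [gridIndex, Prod.ext_iff] at hxy
  have k0 := key hs.1 (hx.1 0).1.le (hy.1 0).1.le hxy.1
  have k1 := key hs.2 (hx.1 1).1.le (hy.1 1).1.le hxy.2
  rw [EuclideanSpace.dist_eq, Fin.sum_univ_two]
  refine Real.sqrt_le_iff.2 ⟨by positivity, ?_⟩
  rw [Real.dist_eq, Real.dist_eq, ← sq_abs, ← sq_abs (|x 1 - y 1|), abs_abs, abs_abs]
  nlinarith [mul_self_le_mul_self (abs_nonneg _) k0, mul_self_le_mul_self (abs_nonneg _) k1,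
    inv_pos.2 h1, inv_pos.2 h2, mul_pos (inv_pos.2 h1) (inv_pos.2 h2)]

theorem partitionNorm_gridPartition_le {s : ℕ × ℕ} (hs : 0 < s.1 ∧ 0 < s.2) :
    partitionNorm (gridPartition s) ≤ (s.1 : ℝ)⁻¹ + (s.2 : ℝ)⁻¹ := by
  refine Real.sSup_le ?_ (by positivity)
  rintro _ ⟨_, ⟨a, -, rfl⟩, rfl⟩
  exact Metric.diam_le_of_forall_dist_le (by positivity) fun x hx y hy =>
    dist_le_of_mem_gridCell hs hx hy

theorem partitionNorm_nonneg {d : ℕ} (Q : Set (Set (E d))) : 0 ≤ partitionNorm Q := by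
  refine Real.sSup_nonneg ?_
  rintro _ ⟨B, -, rfl⟩
  exact Metric.diam_nonneg

theorem cell_gridPartition {s : ℕ × ℕ} (hs : 0 < s.1 ∧ 0 < s.2) {x : E 2} (hx : x ∈ cube 2) :
    cell (gridPartition s) x = gridCell s (gridIndex s x) := by
  ext y
  simp only [cell, gridPartition, Set.mem_sUnion, Set.mem_ofPred_eq, Set.mem_image]
  constructor
  · rintro ⟨_, ⟨⟨a, ha, rfl⟩, hxa⟩, hy⟩
    rwa [hxa.2]
  · exact fun hy => ⟨_, ⟨⟨_, gridIndex_mem_gridPositions hs hx, rfl⟩, hx, rfl⟩, hy⟩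

/-! ### Random points meet most hyperbolic crosses -/

open Classical in
/-- If every point of `G` is related to a proportion of at least `1 - c` of `G`, then some choice
of `n` points of `G` leaves a proportion of at most `c ^ n` unrelated to all of them. -/
theorem exists_selection {α : Type*} (U : α → α → Prop) (G : Finset α) (hG : G.Nonempty) {c : ℝ}
    (hc : ∀ x ∈ G, ((G.filter fun y => ¬ U x y).card : ℝ) ≤ c * G.card) (n : ℕ) :
    ∃ ω : Fin n → α, (∀ k, ω k ∈ G) ∧
      ((G.filter fun x => ∀ k, ¬ U x (ω k)).card : ℝ) ≤ c ^ n * G.card := by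
  let A := Fintype.piFinset fun _ : Fin n => G
  have hA : A.Nonempty := Fintype.piFinset_nonempty.2 fun _ => hG
  have hAcard : (A.card : ℝ) = (G.card : ℝ) ^ n := by simp [A]
  -- Double counting over all choices in `G ^ n`: the choices missing a fixed `x` form an `n`-th
  -- power, so they are a proportion of at most `c ^ n`. Some choice is no worse than the average.
  have hswap := Finset.sum_card_bipartiteAbove_eq_sum_card_bipartiteBelow
    (s := A) (t := G) (fun (ω : Fin n → α) x => ∀ k, ¬ U x (ω k))
  simp only [Finset.bipartiteAbove, Finset.bipartiteBelow] at hswap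
  have hbelow : ∀ x ∈ G, ((A.filter fun ω => ∀ k, ¬ U x (ω k)).card : ℝ) ≤ (c * G.card) ^ n := by
    intro x hx
    have : (A.filter fun ω => ∀ k, ¬ U x (ω k)) =
        Fintype.piFinset fun _ : Fin n => G.filter fun y => ¬ U x y := by
      ext ω
      simp [A, Fintype.mem_piFinset, forall_and]
    rw [this, Fintype.card_piFinset]
    push_cast
    rw [Finset.prod_const, Finset.card_univ, Fintype.card_fin]
    exact pow_le_pow_left₀ (by positivity) (hc x hx) n
  have hsum : ∑ ω ∈ A, ((G.filter fun x => ∀ k, ¬ U x (ω k)).card : ℝ) ≤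
      ∑ _ω ∈ A, c ^ n * G.card := by
    rw [← Nat.cast_sum, hswap, Nat.cast_sum, Finset.sum_const, nsmul_eq_mul, hAcard]
    refine (Finset.sum_le_sum hbelow).trans_eq ?_
    rw [Finset.sum_const, nsmul_eq_mul, mul_pow]
    ring
  obtain ⟨ω, hω, h⟩ := Finset.exists_le_of_sum_le hA hsum
  exact ⟨ω, Fintype.mem_piFinset.1 hω, h⟩

/-- The points `y` sharing with `x` some rectangle of `2 ^ (i + 1)` columns and `2 ^ (m - 1 - i)`
rows that is aligned to the multiples of its side lengths. -/
def SharesRectangle (m : ℕ) (x y : ℕ × ℕ) : Prop :=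
  ∃ i < m, x.1 / 2 ^ (i + 1) = y.1 / 2 ^ (i + 1) ∧ x.2 / 2 ^ (m - 1 - i) = y.2 / 2 ^ (m - 1 - i)

/-- The aligned interval of length `2 ^ i` that contains `a`. -/
def alignedInterval (i a : ℕ) : Finset ℕ := Finset.Ico (a / 2 ^ i * 2 ^ i) ((a / 2 ^ i + 1) * 2 ^ i)

theorem mem_alignedInterval {i a y : ℕ} : y ∈ alignedInterval i a ↔ a / 2 ^ i = y / 2 ^ i := by
  rw [alignedInterval, Finset.mem_Ico, eq_comm, Nat.div_eq_iff (by positivity)]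
  have : 0 < 2 ^ i := by positivity
  rw [add_mul]
  omega

theorem card_alignedInterval (i a : ℕ) : (alignedInterval i a).card = 2 ^ i := by
  rw [alignedInterval, Nat.card_Ico, add_mul]
  omega

theorem alignedInterval_mono {i j : ℕ} (h : i ≤ j) (a : ℕ) :
    alignedInterval i a ⊆ alignedInterval j a := by
  intro y hy
  rw [mem_alignedInterval] at hy ⊢
  obtain ⟨k, rfl⟩ := Nat.exists_eq_add_of_le h
  rw [pow_add, ← Nat.div_div_eq_div_mul, ← Nat.div_div_eq_div_mul, hy]

theorem alignedInterval_subset_range {K m i a : ℕ} (hi : i ≤ m) (ha : a < K * 2 ^ m) :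
    alignedInterval i a ⊆ Finset.range (K * 2 ^ m) := by
  obtain ⟨k, rfl⟩ := Nat.exists_eq_add_of_le hi
  intro y hy
  rw [mem_alignedInterval] at hy
  have e : K * 2 ^ (i + k) = 2 ^ i * (K * 2 ^ k) := by ring
  rw [e] at ha
  have := Nat.div_lt_of_lt_mul ha
  rw [Finset.mem_range, e, mul_comm]
  rw [hy] at this
  exact (Nat.div_lt_iff_lt_mul (by positivity)).1 this

-- Each of the `m` rectangles around `x` has `2 ^ m` points. Keeping only the half of its columns
-- outside the next narrower interval around `x.1` makes the pieces disjoint, with `2 ^ (m - 1)`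
-- points each.
open Classical in
theorem card_sharesRectangle {K m : ℕ} {x : ℕ × ℕ}
    (hx : x ∈ gridPositions (K * 2 ^ m, K * 2 ^ m)) :
    m * 2 ^ m ≤
      2 * ((gridPositions (K * 2 ^ m, K * 2 ^ m)).filter fun y => SharesRectangle m x y).card := by
  simp only [gridPositions, Finset.mem_product, Finset.mem_range] at hx
  let A : ℕ → Finset (ℕ × ℕ) := fun i =>
    (alignedInterval (i + 1) x.1 \ alignedInterval i x.1) ×ˢ alignedInterval (m - 1 - i) x.2
  have hdisj : ∀ i j, i < j → Disjoint (A i) (A j) := by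
    intro i j hij
    rw [Finset.disjoint_left]
    intro y hy hy'
    simp only [A, Finset.mem_product, Finset.mem_sdiff] at hy hy'
    exact hy'.1.2 (alignedInterval_mono hij _ hy.1.1)
  have hcard : ∀ i ∈ Finset.range m, (A i).card = 2 ^ (m - 1) := by
    intro i hi
    have hi := Finset.mem_range.1 hi
    rw [Finset.card_product, Finset.card_sdiff_of_subset (alignedInterval_mono (Nat.le_succ i) _),
      card_alignedInterval, card_alignedInterval, card_alignedInterval, pow_succ,
      Nat.mul_two, Nat.add_sub_cancel, ← pow_add]
    congr 1
    omega
  have hsub : (Finset.range m).biUnion A ⊆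
      (gridPositions (K * 2 ^ m, K * 2 ^ m)).filter fun y => SharesRectangle m x y := by
    intro y hy
    obtain ⟨i, hi, hy⟩ := Finset.mem_biUnion.1 hy
    have hi := Finset.mem_range.1 hi
    simp only [A, Finset.mem_product, Finset.mem_sdiff] at hy
    rw [Finset.mem_filter, gridPositions, Finset.mem_product]
    exact ⟨⟨alignedInterval_subset_range hi hx.1 hy.1.1,
      alignedInterval_subset_range (by omega) hx.2 hy.2⟩,
      i, hi, mem_alignedInterval.1 hy.1.1, mem_alignedInterval.1 hy.2⟩
  have h := Finset.card_le_card hsub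
  rw [Finset.card_biUnion, Finset.sum_congr rfl hcard, Finset.sum_const, Finset.card_range,
    smul_eq_mul] at h
  · rcases Nat.eq_zero_or_pos m with rfl | hm
    · simp
    · calc m * 2 ^ m = 2 * (m * 2 ^ (m - 1)) := by
            obtain ⟨k, rfl⟩ := Nat.exists_eq_add_of_le' hm
            rw [Nat.add_sub_cancel, pow_succ]
            ring
        _ ≤ _ := Nat.mul_le_mul_left 2 h
  · intro i _ j _ hij
    rcases lt_or_gt_of_ne hij with h | h
    exacts [hdisj i j h, (hdisj j i h).symm]

theorem floor_mul_div (n c : ℕ) (hc : 0 < c) (y : ℝ) :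
    ⌊((n * c : ℕ) : ℝ) * y⌋₊ / c = ⌊(n : ℝ) * y⌋₊ := by
  rw [← Nat.floor_div_natCast]
  congr 1
  have : (c : ℝ) ≠ 0 := by exact_mod_cast hc.ne'
  push_cast
  field_simp

/-! ### A function of small integral with large averages -/

/-- The grid of rectangles of area `(K ^ 2 * 2 ^ m)⁻¹` used at step `i`. -/
def stretchedGrid (K m i : ℕ) : ℕ × ℕ := (K * 2 ^ (m - 1 - i), K * 2 ^ (i + 1))

theorem gridIndex_stretchedGrid {K m i : ℕ} (hi : i < m) (x : E 2) :
    gridIndex (stretchedGrid K m i) x =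
      ((gridIndex (K * 2 ^ m, K * 2 ^ m) x).1 / 2 ^ (i + 1),
       (gridIndex (K * 2 ^ m, K * 2 ^ m) x).2 / 2 ^ (m - 1 - i)) := by
  have e1 : K * 2 ^ m = K * 2 ^ (m - 1 - i) * 2 ^ (i + 1) := by
    rw [mul_assoc, ← pow_add]
    congr 2
    omega
  have e2 : K * 2 ^ m = K * 2 ^ (i + 1) * 2 ^ (m - 1 - i) := by
    rw [mul_assoc, ← pow_add]
    congr 2
    omega
  simp only [gridIndex, stretchedGrid]
  congr 1
  · rw [e1, floor_mul_div _ _ (by positivity)]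
  · rw [e2, floor_mul_div _ _ (by positivity)]

/-- With `m = a + k` and `n = K ^ 2 * 2 ^ k`, the mass is `M / 2 ^ a` and the missed proportion is
at most `exp (-m / 2 ^ (a + 1))`. So `a` is fixed by the mass, and then `m` is taken large; the
factor `m` in the cross makes the exponent diverge. -/
theorem exists_parameters (M K : ℕ) (hK : 0 < K) {δ : ℝ} (hδ : 0 < δ) :
    ∃ m n : ℕ, (n : ℝ) * (M * 2 ^ m) * ((K * 2 ^ m) * (K * 2 ^ m) : ℝ)⁻¹ ≤ δ ∧
      (1 - (m : ℝ) / (2 * K ^ 2 * 2 ^ m)) ^ n ≤ δ ∧ 0 ≤ 1 - (m : ℝ) / (2 * K ^ 2 * 2 ^ m) := by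
  have hKr : (1 : ℝ) ≤ K := by exact_mod_cast hK
  obtain ⟨a, ha⟩ : ∃ a : ℕ, (M : ℝ) * (1 / 2) ^ a < δ := by
    have : Tendsto (fun a : ℕ => (M : ℝ) * (1 / 2) ^ a) atTop (𝓝 (M * 0)) :=
      (tendsto_pow_atTop_nhds_zero_of_lt_one (by norm_num) (by norm_num)).const_mul _
    rw [mul_zero] at this
    exact (this.eventually_lt_const hδ).exists
  obtain ⟨m, hm, ham⟩ : ∃ m : ℕ, Real.exp (-((m : ℝ) / 2 ^ (a + 1))) < δ ∧ a ≤ m := by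
    have h1 : Tendsto (fun m : ℕ => (m : ℝ) / 2 ^ (a + 1)) atTop atTop :=
      tendsto_natCast_atTop_atTop.atTop_div_const (by positivity)
    have h2 := Real.tendsto_exp_neg_atTop_nhds_zero.comp h1
    exact ((h2.eventually_lt_const hδ).and (eventually_ge_atTop a)).exists
  obtain ⟨k, rfl⟩ := Nat.exists_eq_add_of_le ham
  have hpos : 0 ≤ 1 - ((a + k : ℕ) : ℝ) / (2 * K ^ 2 * 2 ^ (a + k)) := by
    rw [sub_nonneg, div_le_one (by positivity)]
    have h1 : ((a + k : ℕ) : ℝ) ≤ 2 ^ (a + k) := by exact_mod_cast Nat.lt_two_pow_self.le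
    have h2 : (1 : ℝ) ≤ 2 * K ^ 2 := by nlinarith
    nlinarith [pow_pos (two_pos : (0 : ℝ) < 2) (a + k)]
  refine ⟨a + k, K ^ 2 * 2 ^ k, ?_, ?_, hpos⟩
  · refine le_trans (le_of_eq ?_) ha.le
    push_cast
    rw [pow_add, one_div, inv_pow]
    field_simp
  · refine le_trans (le_trans (pow_le_pow_left₀ hpos (Real.one_sub_le_exp_neg _) _) ?_) hm.le
    rw [← Real.exp_nat_mul]
    refine le_of_eq (congrArg _ ?_)
    push_cast
    rw [pow_add, pow_succ]
    field_simp
    ring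

/-- The mass that `f` gives to the rectangle containing `x` in the grid `s` is at least `M` times
the area of that rectangle. -/
def HasLargeAverage (f : E 2 → ENNReal) (M : ℕ) (s : ℕ × ℕ) (x : E 2) : Prop :=
  (M : ENNReal) * uniform 2 (gridCell s (gridIndex s x)) ≤
    ∫⁻ y in gridCell s (gridIndex s x), f y ∂(uniform 2)

/-- The function has height at least `M * 2 ^ m` on each selected cell of the fine grid. A stretched
rectangle has the area of `2 ^ m` fine cells, so one selected cell inside it already yields average
`M`. -/
theorem exists_large_averages (M K : ℕ) (hM : 0 < M) (hK : 0 < K) {δ : ℝ} (hδ : 0 < δ) :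
    ∃ (m : ℕ) (s : Fin m → ℕ × ℕ) (f : E 2 → ENNReal),
      (∀ i, K ≤ (s i).1 ∧ K ≤ (s i).2) ∧ Measurable f ∧ (∀ x, f x = 0 ∨ 1 ≤ f x) ∧
      ∫⁻ x, f x ∂(uniform 2) ≤ ENNReal.ofReal δ ∧
      uniform 2 {x | ∀ i, ¬ HasLargeAverage f M (s i) x} ≤ ENNReal.ofReal δ := by
  classical
  obtain ⟨m, n, hmass, hunc, hc0⟩ := exists_parameters M K hK hδ
  have hKr : (0 : ℝ) < K := by exact_mod_cast hK
  set L : ℕ × ℕ := (K * 2 ^ m, K * 2 ^ m) with hL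
  have hLpos : 0 < L.1 ∧ 0 < L.2 := by constructor <;> positivity
  have hcardG : ((gridPositions L).card : ℝ) = (K * 2 ^ m) * (K * 2 ^ m) := by
    simp [gridPositions, hL]
  have hGne : (gridPositions L).Nonempty := ⟨(0, 0), by simpa [gridPositions] using hLpos⟩
  have hc : ∀ x ∈ gridPositions L,
      (((gridPositions L).filter fun y => ¬ SharesRectangle m x y).card : ℝ) ≤
        (1 - (m : ℝ) / (2 * K ^ 2 * 2 ^ m)) * (gridPositions L).card := by
    intro x hx
    have h1 : (m : ℝ) * 2 ^ m ≤
        2 * ((gridPositions L).filter fun y => SharesRectangle m x y).card := by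
      exact_mod_cast card_sharesRectangle hx
    have h2 : (((gridPositions L).filter fun y => SharesRectangle m x y).card : ℝ) +
        ((gridPositions L).filter fun y => ¬ SharesRectangle m x y).card =
          (gridPositions L).card := by
      exact_mod_cast Finset.card_filter_add_card_filter_not _
    have h3 : (m : ℝ) / (2 * K ^ 2 * 2 ^ m) * (gridPositions L).card = m * 2 ^ m / 2 := by
      rw [hcardG]
      field_simp
    rw [sub_mul, h3]
    linarith
  obtain ⟨ω, hωG, hω⟩ := exists_selection (SharesRectangle m) (gridPositions L) hGne hc n
  have hvol : ∀ a ∈ gridPositions L,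
      uniform 2 (gridCell L a) = ENNReal.ofReal (((K * 2 ^ m) * (K * 2 ^ m) : ℝ)⁻¹) := by
    intro a ha
    rw [uniform_gridCell ha]
    simp [hL]
  let f : E 2 → ENNReal := fun x =>
    ∑ k, (gridCell L (ω k)).indicator (fun _ => (M : ENNReal) * 2 ^ m) x
  have hfm : Measurable f := Finset.measurable_sum _ fun k _ =>
    measurable_const.indicator (measurableSet_gridCell L (ω k))
  have hle : ∀ k, ∀ x ∈ gridCell L (ω k), (M : ENNReal) * 2 ^ m ≤ f x := by
    intro k x hx
    have := Finset.single_le_sum (f := fun k => (gridCell L (ω k)).indicator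
      (fun _ => (M : ENNReal) * 2 ^ m) x) (fun _ _ => zero_le) (Finset.mem_univ k)
    rwa [Set.indicator_of_mem hx] at this
  refine ⟨m, fun i => stretchedGrid K m i, f, ?_, hfm, ?_, ?_, ?_⟩
  · exact fun i => ⟨Nat.le_mul_of_pos_right K (by positivity),
      Nat.le_mul_of_pos_right K (by positivity)⟩
  · intro x
    by_cases h : ∃ k, x ∈ gridCell L (ω k)
    · right
      obtain ⟨k, hk⟩ := h
      refine le_trans ?_ (hle k x hk)
      exact_mod_cast Nat.one_le_iff_ne_zero.2 (by positivity : M * 2 ^ m ≠ 0)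
    · left
      push Not at h
      exact Finset.sum_eq_zero fun k _ => Set.indicator_of_notMem (h k) _
  · have e : ∀ k, ∫⁻ x, (gridCell L (ω k)).indicator (fun _ => (M : ENNReal) * 2 ^ m) x
        ∂(uniform 2) = ENNReal.ofReal (M * 2 ^ m * ((K * 2 ^ m) * (K * 2 ^ m) : ℝ)⁻¹) := by
      intro k
      rw [lintegral_indicator_const (measurableSet_gridCell L (ω k)), hvol _ (hωG k),
        ENNReal.ofReal_mul (by positivity), ENNReal.ofReal_mul (by positivity),
        ENNReal.ofReal_pow (by norm_num)]
      simp
    rw [lintegral_finsetSum _ fun k _ =>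
      measurable_const.indicator (measurableSet_gridCell L (ω k)), Finset.sum_congr rfl
        fun k _ => e k, Finset.sum_const, Finset.card_univ, Fintype.card_fin, nsmul_eq_mul,
      ← ENNReal.ofReal_natCast, ← ENNReal.ofReal_mul (by positivity)]
    refine ENNReal.ofReal_le_ofReal ?_
    rwa [← mul_assoc]
  · have hlarge : ∀ x ∈ cube 2, (∃ k, SharesRectangle m (gridIndex L x) (ω k)) →
        ∃ i : Fin m, HasLargeAverage f M (stretchedGrid K m i) x := by
      rintro x hx ⟨k, i, hi, h1, h2⟩
      refine ⟨⟨i, hi⟩, ?_⟩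
      set s := stretchedGrid K m i with hs
      have hspos : 0 < s.1 ∧ 0 < s.2 := by constructor <;> simp only [hs, stretchedGrid] <;> positivity
      have hsub : gridCell L (ω k) ⊆ gridCell s (gridIndex s x) := by
        intro y hy
        refine ⟨hy.1, ?_⟩
        rw [hs, gridIndex_stretchedGrid hi, gridIndex_stretchedGrid hi, ← hL, h1, h2, hy.2]
      have harea : (s.1 * s.2 : ℝ) = K ^ 2 * 2 ^ m := by
        simp only [hs, stretchedGrid]
        push_cast
        have : (2 : ℝ) ^ m = 2 ^ (m - 1 - i) * 2 ^ (i + 1) := by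
          rw [← pow_add]
          congr 1
          omega
        rw [this]
        ring
      change (M : ENNReal) * uniform 2 (gridCell s (gridIndex s x)) ≤
        ∫⁻ y in gridCell s (gridIndex s x), f y ∂(uniform 2)
      calc (M : ENNReal) * uniform 2 (gridCell s (gridIndex s x))
          = (M : ENNReal) * 2 ^ m * uniform 2 (gridCell L (ω k)) := by
            rw [uniform_gridCell (gridIndex_mem_gridPositions hspos hx), hvol _ (hωG k), harea,
              mul_assoc]
            congr 1
            have : (2 : ENNReal) ^ m = ENNReal.ofReal (2 ^ m) := by
              rw [ENNReal.ofReal_pow (by norm_num)]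
              simp
            rw [this, ← ENNReal.ofReal_mul (by positivity)]
            congr 1
            field_simp
        _ = ∫⁻ y in gridCell L (ω k), (M : ENNReal) * 2 ^ m ∂(uniform 2) := by
            rw [setLIntegral_const]
        _ ≤ ∫⁻ y in gridCell L (ω k), f y ∂(uniform 2) :=
            setLIntegral_mono hfm fun y hy => hle k y hy
        _ ≤ ∫⁻ y in gridCell s (gridIndex s x), f y ∂(uniform 2) := lintegral_mono_set hsub
    let B := (gridPositions L).filter fun x => ∀ k, ¬ SharesRectangle m x (ω k)
    have hsub : {x | ∀ i : Fin m, ¬ HasLargeAverage f M (stretchedGrid K m i) x} ⊆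
        (⋃ a ∈ B, gridCell L a) ∪ (cube 2)ᶜ := by
      intro x hx
      by_cases hxc : x ∈ cube 2
      · left
        simp only [Set.mem_iUnion, exists_prop]
        refine ⟨gridIndex L x, Finset.mem_filter.2 ⟨gridIndex_mem_gridPositions hLpos hxc, ?_⟩,
          hxc, rfl⟩
        intro k hk
        obtain ⟨i, hi⟩ := hlarge x hxc ⟨k, hk⟩
        exact hx i hi
      · exact Or.inr hxc
    calc uniform 2 {x | ∀ i : Fin m, ¬ HasLargeAverage f M (stretchedGrid K m i) x}
        ≤ uniform 2 (⋃ a ∈ B, gridCell L a) + uniform 2 (cube 2)ᶜ :=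
          (measure_mono hsub).trans (measure_union_le _ _)
      _ = uniform 2 (⋃ a ∈ B, gridCell L a) := by
          rw [show uniform 2 (cube 2)ᶜ = 0 from ae_mem_cube, add_zero]
      _ ≤ ∑ a ∈ B, uniform 2 (gridCell L a) := measure_biUnion_finset_le _ _
      _ = ENNReal.ofReal (B.card * ((K * 2 ^ m) * (K * 2 ^ m) : ℝ)⁻¹) := by
          rw [Finset.sum_congr rfl fun a ha => hvol a (Finset.mem_filter.1 ha).1, Finset.sum_const,
            nsmul_eq_mul, ENNReal.ofReal_mul (by positivity), ENNReal.ofReal_natCast]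
      _ ≤ ENNReal.ofReal δ := by
          refine ENNReal.ofReal_le_ofReal (le_trans ?_ hunc)
          rw [← div_eq_mul_inv, div_le_iff₀ (by positivity), ← hcardG]
          exact hω

theorem exists_divergent_grids {δ : ℝ} (hδ : 0 < δ) :
    ∃ (R : ℕ → ℕ × ℕ) (F : E 2 → ENNReal),
      (∀ k, 0 < (R k).1 ∧ 0 < (R k).2) ∧
      Tendsto (fun k => (R k).1) atTop atTop ∧ Tendsto (fun k => (R k).2) atTop atTop ∧
      Measurable F ∧ (∀ x, F x = 0 ∨ 1 ≤ F x) ∧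
      ∫⁻ x, F x ∂(uniform 2) ≤ ENNReal.ofReal δ ∧
      ∀ᵐ x ∂(uniform 2), ∀ M : ℕ, ∃ᶠ k in atTop, HasLargeAverage F M (R k) x := by
  have hδn : ∀ n : ℕ, 0 < δ / 2 / 2 ^ n := fun n => by positivity
  have htsum : ∑' n : ℕ, ENNReal.ofReal (δ / 2 / 2 ^ n) = ENNReal.ofReal δ := by
    rw [← ENNReal.ofReal_tsum_of_nonneg (fun n => (hδn n).le) (summable_geometric_two' δ),
      tsum_geometric_two']
  choose m s f hs hfm hf01 hmass hbad using fun n : ℕ =>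
    exists_large_averages (n + 1) (n + 1) n.succ_pos n.succ_pos (hδn n)
  -- All grids of all levels are enumerated as one sequence. The extra `none` at each level, a
  -- square grid, keeps the index type infinite even if some `m n` vanish.
  let I := Σ n : ℕ, Option (Fin (m n))
  have : Infinite I := Infinite.of_injective (fun n : ℕ => (⟨n, none⟩ : I)) fun a b h => by
    simpa using congrArg Sigma.fst h
  obtain ⟨e⟩ : Nonempty (ℕ ≃ I) := nonempty_equiv_of_countable
  let r : I → ℕ × ℕ := fun i => i.2.elim (i.1 + 1, i.1 + 1) (s i.1)
  have hr : ∀ i : I, i.1 + 1 ≤ (r i).1 ∧ i.1 + 1 ≤ (r i).2 := by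
    rintro ⟨n, _ | j⟩
    exacts [⟨le_rfl, le_rfl⟩, hs n j]
  -- Each level contains finitely many grids and `e` is injective, so the level tends to infinity in
  -- any enumeration.
  have hlevel : Tendsto (fun k => (e k).1) atTop atTop := by
    rw [← Nat.cofinite_eq_atTop]
    refine Tendsto.comp (y := cofinite) ?_ e.injective.tendsto_cofinite
    refine Tendsto.cofinite_of_finite_preimage_singleton fun n => ?_
    refine Set.Finite.subset (Set.finite_range fun o : Option (Fin (m n)) => (⟨n, o⟩ : I)) ?_
    rintro ⟨n', o⟩ rfl
    exact ⟨o, rfl⟩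
  refine ⟨fun k => r (e k), fun x => ∑' n, f n x, ?_, ?_, ?_, ?_, ?_, ?_, ?_⟩
  · exact fun k => ⟨(Nat.succ_pos _).trans_le (hr (e k)).1, (Nat.succ_pos _).trans_le (hr (e k)).2⟩
  · exact tendsto_atTop_mono (fun k => (Nat.le_succ _).trans (hr (e k)).1) hlevel
  · exact tendsto_atTop_mono (fun k => (Nat.le_succ _).trans (hr (e k)).2) hlevel
  · exact Measurable.tsum hfm
  · intro x
    by_cases h : ∀ n, f n x = 0
    · exact Or.inl (by simp [h])
    · push Not at h
      obtain ⟨n, hn⟩ := h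
      exact Or.inr (((hf01 n x).resolve_left hn).trans (ENNReal.le_tsum n))
  · rw [lintegral_tsum fun n => (hfm n).aemeasurable]
    exact (ENNReal.tsum_le_tsum hmass).trans htsum.le
  · have hsum : ∑' n, uniform 2 {x | ∀ i, ¬ HasLargeAverage (f n) (n + 1) (s n i) x} ≠ ⊤ :=
      ne_top_of_le_ne_top ENNReal.ofReal_ne_top ((ENNReal.tsum_le_tsum hbad).trans htsum.le)
    -- Borel–Cantelli: almost every `x` has a large average at every level from some `n₀` on. Levels
    -- `n + (n₀ + M)` are past `n₀` and have threshold above `M`.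
    filter_upwards [ae_eventually_notMem hsum] with x hx M
    obtain ⟨n₀, hn₀⟩ := eventually_atTop.1 hx
    rw [← Nat.cofinite_eq_atTop, frequently_cofinite_iff_infinite]
    have hgood : ∀ n, ∃ i : Fin (m (n + (n₀ + M))),
        HasLargeAverage (f (n + (n₀ + M))) (n + (n₀ + M) + 1) (s (n + (n₀ + M)) i) x := by
      intro n
      simpa using hn₀ (n + (n₀ + M)) (by omega)
    choose i hi using hgood
    refine Set.infinite_of_injective_forall_mem
      (f := fun n => e.symm ⟨n + (n₀ + M), some (i n)⟩) ?_ ?_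
    · intro a b hab
      have := congrArg Sigma.fst (e.symm.injective hab)
      simpa using this
    · intro n
      have hre : r (e (e.symm ⟨n + (n₀ + M), some (i n)⟩)) = s (n + (n₀ + M)) (i n) := by
        rw [Equiv.apply_symm_apply]
        rfl
      rw [Set.mem_ofPred_eq, hre]
      refine le_trans ?_ ((hi n).trans (lintegral_mono fun y => ENNReal.le_tsum _))
      gcongr
      omega

/-! ### Sampling: the law of large numbers along slowly growing partitions -/

theorem IsIID.map_eq {Ω S : Type*} [MeasurableSpace Ω] [MeasurableSpace S] {P : Measure Ω}
    [IsProbabilityMeasure P] {ν : Measure S} {Z : ℕ → Ω → S} (h : IsIID P ν Z) :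
    P.map (fun ω n => Z n ω) = Measure.infinitePi fun _ => ν := by
  rw [(iIndepFun_iff_map_fun_eq_infinitePi_map h.measurable).1 h.indep]
  simp only [h.law]

theorem IsIID.measure_preimage {Ω S : Type*} [MeasurableSpace Ω] [MeasurableSpace S]
    {P : Measure Ω} [IsProbabilityMeasure P] {ν : Measure S} {Z : ℕ → Ω → S} (h : IsIID P ν Z)
    {t : Set (ℕ → S)} (ht : MeasurableSet t) :
    P {ω | (fun n => Z n ω) ∈ t} = Measure.infinitePi (fun _ => ν) t := by
  rw [← h.map_eq, Measure.map_apply (measurable_pi_lambda _ h.measurable) ht]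
  rfl

theorem ae_tendsto_sample_average {S : Type*} [MeasurableSpace S] {ν : Measure S}
    [IsProbabilityMeasure ν] {φ : S → ℝ} (hφ : Measurable φ) (hint : Integrable φ ν) :
    ∀ᵐ z ∂(Measure.infinitePi fun _ : ℕ => ν),
      Tendsto (fun N : ℕ => (∑ n ∈ Finset.Icc 1 N, φ (z n)) / N) atTop (𝓝 (∫ x, φ x ∂ν)) := by
  have hmp : ∀ n : ℕ, MeasurePreserving (fun z : ℕ → S => z n)
      (Measure.infinitePi fun _ : ℕ => ν) ν := fun n =>
    measurePreserving_eval_infinitePi (fun _ : ℕ => ν) n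
  have hindep : iIndepFun (fun (n : ℕ) (z : ℕ → S) => φ (z n))
      (Measure.infinitePi fun _ : ℕ => ν) := iIndepFun_infinitePi fun _ => hφ
  -- The index is shifted by one because observation `0` is the test case and the sample starts at
  -- `1`.
  have h := strong_law_ae_real (μ := Measure.infinitePi fun _ : ℕ => ν)
    (fun n z => φ (z (n + 1))) ((hmp 1).integrable_comp_of_integrable hint)
    (fun i j hij => hindep.indepFun (by simpa using hij))
    (fun i => ⟨(hφ.comp (measurable_pi_apply _)).aemeasurable,
      (hφ.comp (measurable_pi_apply _)).aemeasurable, by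
        have e : ∀ n : ℕ, Measure.map (fun z : ℕ → S => φ (z n))
            (Measure.infinitePi fun _ : ℕ => ν) = ν.map φ := fun n => by
          exact (Measure.map_map hφ (measurable_pi_apply n)).symm.trans
            (congrArg (Measure.map φ) (hmp n).map_eq)
        rw [e, e]⟩)
  have hint1 : ∫ z, φ (z (0 + 1)) ∂(Measure.infinitePi fun _ : ℕ => ν) = ∫ x, φ x ∂ν := by
    have := integral_map (μ := Measure.infinitePi fun _ : ℕ => ν) (f := φ)
      (measurable_pi_apply 1).aemeasurable (by
        rw [(hmp 1).map_eq]
        exact hφ.aestronglyMeasurable)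
    rw [(hmp 1).map_eq] at this
    exact this.symm
  rw [hint1] at h
  filter_upwards [h] with z hz
  convert hz using 3 with N
  rw [Finset.range_eq_Ico, Finset.sum_Ico_add' (fun n => φ (z n)) 0 N 1]
  rfl

/-- Statistics that converge almost surely for every fixed index are uniformly close to their
limits from some time on, off a small set that depends on the index only. -/
theorem exists_uniform_times {α : Type*} [MeasurableSpace α] (μ : Measure α) [IsFiniteMeasure μ]
    (D : ℕ → ℕ → α → ℝ) (hD : ∀ k N, Measurable (D k N))
    (hlim : ∀ k, ∀ᵐ z ∂μ, Tendsto (fun N => D k N z) atTop (𝓝 0)) :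
    ∃ (T : ℕ → ℕ) (t : ℕ → Set α), (∀ k, MeasurableSet (t k)) ∧
      (∀ k, μ (t k) ≤ ENNReal.ofReal (1 / 2 / 2 ^ k)) ∧
      ∀ k, ∀ z ∉ t k, ∀ N, T k ≤ N → |D k N z| < 1 / ((k : ℝ) + 1) := by
  have h : ∀ k : ℕ, ∃ (T : ℕ) (t : Set α), MeasurableSet t ∧
      μ t ≤ ENNReal.ofReal (1 / 2 / 2 ^ k) ∧
      ∀ z ∉ t, ∀ N, T ≤ N → |D k N z| < 1 / ((k : ℝ) + 1) := by
    intro k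
    obtain ⟨t, ht, hμ, hu⟩ := tendstoUniformlyOn_of_ae_tendsto'
      (fun N => (hD k N).stronglyMeasurable) (stronglyMeasurable_const (b := (0 : ℝ))) (hlim k)
      (ε := 1 / 2 / 2 ^ k) (by positivity)
    rw [Metric.tendstoUniformlyOn_iff] at hu
    obtain ⟨T, hT⟩ := eventually_atTop.1 (hu (1 / ((k : ℝ) + 1)) (by positivity))
    refine ⟨T, t, ht, hμ, fun z hz N hN => ?_⟩
    simpa using hT N hN z hz
  choose T t h1 h2 h3 using h
  exact ⟨T, t, h1, h2, h3⟩

theorem tsum_half_geometric_ne_top : ∑' k : ℕ, ENNReal.ofReal (1 / 2 / 2 ^ k) ≠ ⊤ := by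
  rw [← ENNReal.ofReal_tsum_of_nonneg (fun k => by positivity) (summable_geometric_two' 1)]
  exact ENNReal.ofReal_ne_top

theorem tendsto_half_geometric :
    Tendsto (fun k : ℕ => ENNReal.ofReal (1 / 2 / 2 ^ k)) atTop (𝓝 0) := by
  have := (summable_geometric_two' (1 : ℝ)).tendsto_atTop_zero
  simpa using ENNReal.tendsto_ofReal this

/-- Every sequence of times admits a slow enumeration of the indices. -/
theorem exists_slow_schedule (T : ℕ → ℕ) :
    ∃ κ : ℕ → ℕ, Tendsto κ atTop atTop ∧ (∀ᶠ N in atTop, T (κ N) ≤ N) ∧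
      ∀ k, ∃ N, k ≤ N ∧ κ N = k := by
  classical
  -- `T'` dominates both `T` and the identity and is strictly increasing, so at time `T' k` the
  -- greatest admissible index is exactly `k`: no grid is skipped.
  let T' : ℕ → ℕ := fun k => k + ∑ i ∈ Finset.range (k + 1), T i
  have hT' : StrictMono T' := strictMono_nat_of_lt_succ fun k => by
    simp only [T', Finset.sum_range_succ _ (k + 1)]
    omega
  have hk : ∀ k, k ≤ T' k := fun k => Nat.le_add_right _ _
  have hle : ∀ k, T k ≤ T' k := fun k =>
    (Finset.single_le_sum (f := T) (fun _ _ => Nat.zero_le _)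
      (Finset.self_mem_range_succ k)).trans (Nat.le_add_left _ _)
  let κ : ℕ → ℕ := fun N => Nat.findGreatest (fun k => T' k ≤ N) N
  refine ⟨κ, ?_, ?_, fun k => ⟨T' k, hk k, ?_⟩⟩
  · refine tendsto_atTop.2 fun k => eventually_atTop.2 ⟨T' k, fun N hN => ?_⟩
    exact Nat.le_findGreatest ((hk k).trans hN) hN
  · refine eventually_atTop.2 ⟨T' 0, fun N hN => (hle _).trans ?_⟩
    exact Nat.findGreatest_spec (P := fun k => T' k ≤ N) (Nat.zero_le N) hN
  · refine le_antisymm ?_ (Nat.le_findGreatest (hk k) le_rfl)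
    exact hT'.le_iff_le.1 (Nat.findGreatest_spec (P := fun j => T' j ≤ T' k) (Nat.zero_le _)
      (hT'.monotone (Nat.zero_le k)))

/-! ### Averages over grids -/

/-- The average of `u` over the rectangle of the grid `s` that contains `x`. -/
def gridAverage (u : E 2 → ℝ) (s : ℕ × ℕ) (x : E 2) : ℝ :=
  (∫ y in gridCell s (gridIndex s x), u y ∂(uniform 2)) /
    (uniform 2).real (gridCell s (gridIndex s x))

theorem measurable_gridAverage (u : E 2 → ℝ) (s : ℕ × ℕ) : Measurable (gridAverage u s) :=
  (measurable_of_countable fun a : ℕ × ℕ => (∫ y in gridCell s a, u y ∂(uniform 2)) /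
    (uniform 2).real (gridCell s a)).comp (measurable_gridIndex s)

theorem uniform_gridCell_pos {s a : ℕ × ℕ} (ha : a ∈ gridPositions s) :
    0 < uniform 2 (gridCell s a) := by
  rw [uniform_gridCell ha, ← volume_gridCell ha]
  exact volume_gridCell_pos ha

theorem uniform_real_gridCell_pos {s a : ℕ × ℕ} (ha : a ∈ gridPositions s) :
    0 < (uniform 2).real (gridCell s a) :=
  ENNReal.toReal_pos (uniform_gridCell_pos ha).ne' (measure_ne_top _ _)

theorem lintegral_uniform_eq_sum {s : ℕ × ℕ} (hs : 0 < s.1 ∧ 0 < s.2) (φ : E 2 → ENNReal) :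
    ∫⁻ x, φ x ∂(uniform 2) = ∑ a ∈ gridPositions s, ∫⁻ x in gridCell s a, φ x ∂(uniform 2) := by
  rw [← lintegral_biUnion_finset _ fun a _ => measurableSet_gridCell s a]
  · have : (⋃ a ∈ gridPositions s, gridCell s a) =ᵐ[uniform 2] Set.univ := by
      refine eventuallyEq_univ.2 ?_
      filter_upwards [ae_mem_cube] with x hx
      exact Set.mem_biUnion (gridIndex_mem_gridPositions hs hx) ⟨hx, rfl⟩
    rw [Measure.restrict_congr_set this, Measure.restrict_univ]
  · intro a _ b _ hab
    rw [Function.onFun, Set.disjoint_left]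
    rintro x ⟨_, hx⟩ ⟨_, hx'⟩
    exact hab (hx.symm.trans hx')

/-- Averaging contracts the `L¹` norm, cell by cell; this transfers convergence from continuous
functions to integrable ones. -/
theorem lintegral_gridAverage_le {s : ℕ × ℕ} (hs : 0 < s.1 ∧ 0 < s.2) (u : E 2 → ℝ) :
    ∫⁻ x, ‖gridAverage u s x‖ₑ ∂(uniform 2) ≤ ∫⁻ x, ‖u x‖ₑ ∂(uniform 2) := by
  rw [lintegral_uniform_eq_sum hs, lintegral_uniform_eq_sum hs fun x => ‖u x‖ₑ]
  refine Finset.sum_le_sum fun a ha => ?_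
  have hpos := uniform_gridCell_pos ha
  have hposr := uniform_real_gridCell_pos ha
  calc ∫⁻ x in gridCell s a, ‖gridAverage u s x‖ₑ ∂(uniform 2)
      = ∫⁻ x in gridCell s a, ‖(∫ y in gridCell s a, u y ∂(uniform 2)) /
          (uniform 2).real (gridCell s a)‖ₑ ∂(uniform 2) := by
        refine setLIntegral_congr_fun (measurableSet_gridCell s a) fun x hx => ?_
        simp only [gridAverage, hx.2]
    _ = ‖∫ y in gridCell s a, u y ∂(uniform 2)‖ₑ := by
        rw [setLIntegral_const, div_eq_mul_inv, enorm_mul, enorm_inv hposr.ne',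
          Real.enorm_eq_ofReal hposr.le, Measure.real, ENNReal.ofReal_toReal (measure_ne_top _ _),
          mul_assoc, ENNReal.inv_mul_cancel hpos.ne' (measure_ne_top _ _), mul_one]
    _ ≤ ∫⁻ x in gridCell s a, ‖u x‖ₑ ∂(uniform 2) := enorm_integral_le_lintegral_enorm _

theorem gridAverage_sub {u v : E 2 → ℝ} (hu : Integrable u (uniform 2))
    (hv : Integrable v (uniform 2)) (s : ℕ × ℕ) (x : E 2) :
    gridAverage (fun y => u y - v y) s x = gridAverage u s x - gridAverage v s x := by
  rw [gridAverage, integral_sub hu.integrableOn hv.integrableOn, sub_div]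
  rfl

theorem abs_gridAverage_sub_le {s : ℕ × ℕ} (hs : 0 < s.1 ∧ 0 < s.2) {v : E 2 → ℝ}
    (hv : Integrable v (uniform 2)) {x : E 2} (hx : x ∈ cube 2) {c : ℝ}
    (hc : ∀ y, dist y x ≤ (s.1 : ℝ)⁻¹ + (s.2 : ℝ)⁻¹ → |v y - v x| ≤ c) :
    |gridAverage v s x - v x| ≤ c := by
  set C := gridCell s (gridIndex s x) with hC
  have hposr : 0 < (uniform 2).real C :=
    uniform_real_gridCell_pos (gridIndex_mem_gridPositions hs hx)
  have h1 : gridAverage v s x - v x = (∫ y in C, (v y - v x) ∂(uniform 2)) / (uniform 2).real C := by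
    rw [integral_sub hv.integrableOn (integrable_const _), setIntegral_const, smul_eq_mul, sub_div,
      mul_div_cancel_left₀ _ hposr.ne']
    rfl
  rw [h1, abs_div, abs_of_pos hposr, div_le_iff₀ hposr]
  exact norm_setIntegral_le_of_norm_le_const (f := fun y => v y - v x) (measure_lt_top _ _)
    fun y hy => hc y (dist_le_of_mem_gridCell hs hy ⟨hx, rfl⟩)

theorem measure_ge_abs_le {u : E 2 → ℝ} (hu : AEMeasurable u (uniform 2)) {η : ℝ} (hη : 0 < η) :
    uniform 2 {x | η ≤ |u x|} ≤ (∫⁻ x, ‖u x‖ₑ ∂(uniform 2)) / ENNReal.ofReal η := by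
  have h := meas_ge_le_lintegral_div hu.enorm (ENNReal.ofReal_pos.2 hη).ne' ENNReal.ofReal_ne_top
  convert h using 4 with x
  rw [← Real.norm_eq_abs, ← ofReal_norm, ENNReal.ofReal_le_ofReal_iff (norm_nonneg _)]

/-- Averages over grids whose mesh tends to zero converge in measure. -/
theorem tendsto_measure_gridAverage_sub {u : E 2 → ℝ} (hu : Integrable u (uniform 2))
    {s : ℕ → ℕ × ℕ} (hs : ∀ N, 0 < (s N).1 ∧ 0 < (s N).2)
    (h1 : Tendsto (fun N => (s N).1) atTop atTop) (h2 : Tendsto (fun N => (s N).2) atTop atTop)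
    {η : ℝ} (hη : 0 < η) :
    Tendsto (fun N => uniform 2 {x | η ≤ |gridAverage u (s N) x - u x|}) atTop (𝓝 0) := by
  rw [ENNReal.tendsto_nhds_zero]
  intro ε hε
  obtain ⟨r, hr0, hrε⟩ := ENNReal.lt_iff_exists_nnreal_btwn.1 hε
  have hr : (0 : ℝ) < r := by exact_mod_cast hr0
  have hreg : (uniform 2).Regular := by
    unfold uniform
    exact Measure.Regular.restrict_of_measure_ne_top (by
      have := measure_ne_top (uniform 2) Set.univ
      rwa [uniform, Measure.restrict_apply_univ] at this)
  -- The error `r * (η / 3) / 2` is chosen so that Markov's inequality at level `η / 3` costs `r /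
  -- 2` for `u - v` and `r / 2` for its average. The remaining third of `η` is the oscillation of
  -- `v` on a cell.
  obtain ⟨v, hvc, hv, hvcont, hvint⟩ :=
    hu.exists_hasCompactSupport_integral_sub_le (ε := r * (η / 3) / 2) (by positivity)
  have hsub : Integrable (fun x => u x - v x) (uniform 2) := hu.sub hvint
  have hL : ∫⁻ x, ‖u x - v x‖ₑ ∂(uniform 2) ≤ ENNReal.ofReal (r * (η / 3) / 2) := by
    rw [← ofReal_integral_norm_eq_lintegral_enorm hsub]
    exact ENNReal.ofReal_le_ofReal hv
  have hdiv : ENNReal.ofReal (r * (η / 3) / 2) / ENNReal.ofReal (η / 3) = ENNReal.ofReal (r / 2) := by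
    rw [← ENNReal.ofReal_div_of_pos (by positivity)]
    congr 1
    field_simp
  obtain ⟨δ, hδ, hunif⟩ := Metric.uniformContinuous_iff.1
    (hvc.uniformContinuous_of_continuous hvcont) (η / 3) (by positivity)
  have hmesh : Tendsto (fun N => (((s N).1 : ℕ) : ℝ)⁻¹ + (((s N).2 : ℕ) : ℝ)⁻¹) atTop (𝓝 (0 + 0)) :=
    (tendsto_inv_atTop_nhds_zero_nat.comp h1).add (tendsto_inv_atTop_nhds_zero_nat.comp h2)
  rw [add_zero] at hmesh
  filter_upwards [hmesh.eventually_lt_const hδ] with N hN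
  have hincl : {x | η ≤ |gridAverage u (s N) x - u x|} ⊆
      ({x | η / 3 ≤ |gridAverage (fun y => u y - v y) (s N) x|} ∪ {x | η / 3 ≤ |u x - v x|}) ∪
        (cube 2)ᶜ := by
    intro x hx
    by_cases hxc : x ∈ cube 2
    · left
      by_contra hcon
      simp only [Set.mem_union, Set.mem_ofPred_eq, not_or, not_le] at hcon hx
      have h3 : |gridAverage v (s N) x - v x| ≤ η / 3 :=
        abs_gridAverage_sub_le (hs N) hvint hxc fun y hy => by
          rw [← Real.dist_eq]
          exact (hunif (hy.trans_lt hN)).le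
      rw [gridAverage_sub hu hvint, abs_lt, abs_lt] at hcon
      rw [abs_le] at h3
      have : |gridAverage u (s N) x - u x| < η := by
        rw [abs_lt]
        constructor <;> linarith [hcon.1.1, hcon.1.2, hcon.2.1, hcon.2.2, h3.1, h3.2]
      linarith
    · exact Or.inr hxc
  calc uniform 2 {x | η ≤ |gridAverage u (s N) x - u x|}
      ≤ (uniform 2 {x | η / 3 ≤ |gridAverage (fun y => u y - v y) (s N) x|} +
          uniform 2 {x | η / 3 ≤ |u x - v x|}) + uniform 2 (cube 2)ᶜ :=
        (measure_mono hincl).trans ((measure_union_le _ _).trans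
          (add_le_add_left (measure_union_le _ _) _))
    _ ≤ ENNReal.ofReal (r / 2) + ENNReal.ofReal (r / 2) + 0 := by
        refine add_le_add (add_le_add ?_ ?_) (show uniform 2 (cube 2)ᶜ = 0 from ae_mem_cube).le
        · refine (measure_ge_abs_le (measurable_gridAverage _ _).aemeasurable
            (by positivity)).trans (le_trans ?_ hdiv.le)
          exact ENNReal.div_le_div_right ((lintegral_gridAverage_le (hs N) _).trans hL) _
        · refine (measure_ge_abs_le hsub.aestronglyMeasurable.aemeasurable
            (by positivity)).trans (le_trans ?_ hdiv.le)
          exact ENNReal.div_le_div_right hL _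
    _ = r := by
        rw [← ENNReal.ofReal_add (by positivity) (by positivity), add_zero, add_halves,
          ENNReal.ofReal_coe_nnreal]
    _ ≤ ε := hrε.le

/-! ### Cell means and their empirical versions -/

open Classical in
/-- The average of those `Y_n`, `1 ≤ n ≤ N`, for which `X_n ∈ B`, and zero if there are none. -/
def sampleMean {d : ℕ} (B : Set (E d)) (N : ℕ) (z : ℕ → E d × ℝ) : ℝ :=
  if 0 < (∑ n ∈ Finset.Icc 1 N, if (z n).1 ∈ B then (1 : ℝ) else 0) / N then
    ((∑ n ∈ Finset.Icc 1 N, if (z n).1 ∈ B then (z n).2 else 0) / N) /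
      ((∑ n ∈ Finset.Icc 1 N, if (z n).1 ∈ B then (1 : ℝ) else 0) / N)
  else 0

theorem empiricalCellMean_eq_sampleMean {d : ℕ} (Q : Set (Set (E d))) (N : ℕ)
    (z : ℕ → E d × ℝ) (x : E d) : empiricalCellMean Q N z x = sampleMean (cell Q x) N z := rfl

/-- `E(Y 1_B(X)) / P(X ∈ B)` when `(X, Y)` has law `ν`. -/
def meanOn {d : ℕ} (ν : Measure (E d × ℝ)) (B : Set (E d)) : ℝ :=
  (∫ z in {z : E d × ℝ | z.1 ∈ B}, z.2 ∂ν) / ν.real {z : E d × ℝ | z.1 ∈ B}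

theorem cellMean_eq_meanOn {d : ℕ} (ν : Measure (E d × ℝ)) (Q : Set (Set (E d))) (x : E d) :
    cellMean ν Q x = meanOn ν (cell Q x) := rfl

theorem measurableSet_fst_mem {α β : Type*} [MeasurableSpace α] [MeasurableSpace β] {B : Set α}
    (hB : MeasurableSet B) : MeasurableSet {z : α × β | z.1 ∈ B} := measurable_fst hB

open Classical in
theorem measurable_sampleMean {d : ℕ} {B : Set (E d)} (hB : MeasurableSet B) (N : ℕ) :
    Measurable (sampleMean B N) := by
  have hmem : ∀ n : ℕ, MeasurableSet {z : ℕ → E d × ℝ | (z n).1 ∈ B} := fun n =>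
    (measurable_fst.comp (measurable_pi_apply n)) hB
  have h1 : Measurable fun z : ℕ → E d × ℝ =>
      (∑ n ∈ Finset.Icc 1 N, if (z n).1 ∈ B then (1 : ℝ) else 0) / N :=
    (Finset.measurable_sum _ fun n _ =>
      Measurable.ite (hmem n) measurable_const measurable_const).div_const _
  have h2 : Measurable fun z : ℕ → E d × ℝ =>
      (∑ n ∈ Finset.Icc 1 N, if (z n).1 ∈ B then (z n).2 else 0) / N :=
    (Finset.measurable_sum _ fun n _ =>
      Measurable.ite (hmem n) (measurable_snd.comp (measurable_pi_apply n))
        measurable_const).div_const _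
  exact Measurable.ite (measurableSet_lt measurable_const h1) (h2.div h1) measurable_const

open Classical in
theorem ae_tendsto_sampleMean {d : ℕ} {ν : Measure (E d × ℝ)} [IsProbabilityMeasure ν]
    (hint : Integrable (fun z : E d × ℝ => z.2) ν) {B : Set (E d)} (hB : MeasurableSet B)
    (hpos : 0 < ν.real {z : E d × ℝ | z.1 ∈ B}) :
    ∀ᵐ z ∂(Measure.infinitePi fun _ : ℕ => ν),
      Tendsto (fun N => sampleMean B N z) atTop (𝓝 (meanOn ν B)) := by
  have hB' : MeasurableSet {z : E d × ℝ | z.1 ∈ B} := measurableSet_fst_mem hB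
  have e1 : ∫ z, (if z.1 ∈ B then (1 : ℝ) else 0) ∂ν = ν.real {z : E d × ℝ | z.1 ∈ B} := by
    rw [← integral_indicator_one hB']
    rfl
  have e2 : ∫ z, (if z.1 ∈ B then z.2 else 0) ∂ν = ∫ z in {z : E d × ℝ | z.1 ∈ B}, z.2 ∂ν := by
    rw [← integral_indicator hB']
    rfl
  have h1 := ae_tendsto_sample_average (ν := ν) (φ := fun z => if z.1 ∈ B then (1 : ℝ) else 0)
    (Measurable.ite hB' measurable_const measurable_const)
    ((integrable_const (1 : ℝ)).indicator hB')
  have h2 := ae_tendsto_sample_average (ν := ν) (φ := fun z => if z.1 ∈ B then z.2 else 0)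
    (Measurable.ite hB' measurable_snd measurable_const) (hint.indicator hB')
  rw [e1] at h1
  rw [e2] at h2
  filter_upwards [h1, h2] with z hz1 hz2
  refine (hz2.div hz1 hpos.ne').congr' ?_
  -- The limiting frequency is positive, so the default value for an empty cell is eventually not
  -- used.
  filter_upwards [hz1.eventually_const_lt hpos] with N hN
  rw [sampleMean, if_pos hN]
  rfl

/-! ### Noiseless regression on the unit square -/

/-- The law of `(X, g X)` with `X` uniform on the unit cube. -/
def graphLaw {d : ℕ} (g : E d → ℝ) : Measure (E d × ℝ) := (uniform d).map fun x => (x, g x)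

theorem isProbabilityMeasure_graphLaw {g : E 2 → ℝ} (hg : Measurable g) :
    IsProbabilityMeasure (graphLaw g) :=
  Measure.isProbabilityMeasure_map (measurable_id.prodMk hg).aemeasurable

theorem map_fst_graphLaw {g : E 2 → ℝ} (hg : Measurable g) :
    (graphLaw g).map Prod.fst = uniform 2 :=
  (Measure.map_map measurable_fst (measurable_id.prodMk hg)).trans Measure.map_id

/-- As `Y = g X` almost surely, `Y` agrees with a function measurable with respect to `X`, which is
its own conditional expectation. -/
theorem isRegressionModel_graphLaw {g : E 2 → ℝ} (hg : Measurable g) (h0 : ∀ x, 0 ≤ g x)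
    (hint : Integrable g (uniform 2)) : IsRegressionModel (graphLaw g) g := by
  have hm : Measurable fun x : E 2 => (x, g x) := measurable_id.prodMk hg
  have hprob := isProbabilityMeasure_graphLaw hg
  have heq : (fun z : E 2 × ℝ => z.2) =ᵐ[graphLaw g] fun z => g z.1 := by
    exact (ae_map_iff hm.aemeasurable
      (measurableSet_eq_fun measurable_snd (hg.comp measurable_fst))).2 (ae_of_all _ fun x => rfl)
  have hintg : Integrable (fun z : E 2 × ℝ => g z.1) (graphLaw g) :=
    (integrable_map_measure (hg.comp measurable_fst).aestronglyMeasurable hm.aemeasurable).2 hint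
  refine ⟨hprob, map_fst_graphLaw hg, ?_, ?_, hg, h0, ?_⟩
  · filter_upwards [heq] with z hz
    rw [hz]
    exact h0 _
  · exact hintg.congr heq.symm
  · refine EventuallyEq.trans ?_ (condExp_congr_ae heq).symm
    have hle : MeasurableSpace.comap Prod.fst (inferInstance : MeasurableSpace (E 2)) ≤
        (inferInstance : MeasurableSpace (E 2 × ℝ)) := measurable_fst.comap_le
    have hsm : StronglyMeasurable[MeasurableSpace.comap Prod.fst
        (inferInstance : MeasurableSpace (E 2))] fun z : E 2 × ℝ => g z.1 :=
      (hg.comp (comap_measurable Prod.fst)).stronglyMeasurable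
    rw [condExp_of_stronglyMeasurable hle hsm hintg]

theorem graphLaw_real_fst_mem {g : E 2 → ℝ} (hg : Measurable g) {B : Set (E 2)}
    (hB : MeasurableSet B) : (graphLaw g).real {z : E 2 × ℝ | z.1 ∈ B} = (uniform 2).real B := by
  exact map_measureReal_apply (measurable_id.prodMk hg) (measurableSet_fst_mem hB)

theorem meanOn_graphLaw {g : E 2 → ℝ} (hg : Measurable g) (s : ℕ × ℕ) (x : E 2) :
    meanOn (graphLaw g) (gridCell s (gridIndex s x)) = gridAverage g s x := by
  have hm : Measurable fun x : E 2 => (x, g x) := measurable_id.prodMk hg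
  have hC := measurableSet_gridCell s (gridIndex s x)
  rw [meanOn, graphLaw_real_fst_mem hg hC, gridAverage, graphLaw,
    setIntegral_map (measurableSet_fst_mem hC) measurable_snd.aestronglyMeasurable
      hm.aemeasurable]
  rfl

/-! ### The two-class problem -/

theorem classLaw_apply {h : E 2 → ℝ} {S : Set (E 2 × ℕ)} (hS : MeasurableSet S) :
    classLaw h S = 2⁻¹ * ∫⁻ x in {x | (x, 1) ∈ S}, ENNReal.ofReal (h x) ∂(uniform 2) +
      2⁻¹ * uniform 2 {x | (x, 2) ∈ S} := by
  have hm : ∀ c : ℕ, Measurable fun x : E 2 => (x, c) := fun c => measurable_id.prodMk measurable_const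
  rw [classLaw, Measure.prod_dirac, Measure.prod_dirac, Measure.add_apply, Measure.smul_apply,
    Measure.smul_apply, Measure.map_apply (hm 1) hS, Measure.map_apply (hm 2) hS,
    withDensity_apply _ (hm 1 hS)]
  rfl

theorem classLaw_fst_mem (h : E 2 → ℝ) {S : Set (E 2)} (hS : MeasurableSet S) :
    classLaw h {z | z.1 ∈ S} = 2⁻¹ * ∫⁻ x in S, ENNReal.ofReal (h x) ∂(uniform 2) +
      2⁻¹ * uniform 2 S := classLaw_apply (measurableSet_fst_mem hS)

theorem isProbabilityMeasure_classLaw {h : E 2 → ℝ}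
    (hint : ∫⁻ x, ENNReal.ofReal (h x) ∂(uniform 2) = 1) : IsProbabilityMeasure (classLaw h) := by
  constructor
  rw [classLaw_apply MeasurableSet.univ]
  simp only [Set.mem_univ, Set.ofPred_true, Measure.restrict_univ, hint, measure_univ, mul_one]
  exact ENNReal.inv_two_add_inv_two

theorem measurable_bayesRule {h : E 2 → ℝ} (hh : Measurable h) : Measurable (bayesRule h) :=
  Measurable.ite (measurableSet_lt measurable_const hh) measurable_const measurable_const

theorem bayesRule_eq (h : E 2 → ℝ) (x : E 2) : bayesRule h x = 1 ∨ bayesRule h x = 2 := by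
  unfold bayesRule
  split_ifs
  exacts [Or.inl rfl, Or.inr rfl]

theorem measurableSet_error {δ : E 2 → ℕ} (hδ : Measurable δ) :
    MeasurableSet {z : E 2 × ℕ | δ z.1 ≠ z.2} :=
  (measurableSet_eq_fun (hδ.comp measurable_fst) measurable_snd).compl

-- At `x`, deciding `1` errs on class `2`, of density `1`; deciding `2` errs on class `1`, of
-- density `h x`. The Bayes rule therefore minimises the integrand pointwise.
open Classical in
theorem classLaw_error {h : E 2 → ℝ} {δ : E 2 → ℕ} (hδ : IsRule δ) :
    classLaw h {z | δ z.1 ≠ z.2} =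
      2⁻¹ * ∫⁻ x, (if δ x = 1 then 1 else ENNReal.ofReal (h x)) ∂(uniform 2) := by
  have hm : MeasurableSet {x | δ x = 1} := hδ.1 (measurableSet_singleton 1)
  have e1 : {x | (x, 1) ∈ {z : E 2 × ℕ | δ z.1 ≠ z.2}} = {x | δ x = 1}ᶜ := rfl
  have e2 : {x | (x, 2) ∈ {z : E 2 × ℕ | δ z.1 ≠ z.2}} = {x | δ x = 1} := by
    ext x
    simp only [Set.mem_ofPred_eq]
    rcases hδ.2 x with h | h <;> simp [h]
  rw [classLaw_apply (measurableSet_error hδ.1), e1, e2, ← mul_add, add_comm]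
  congr 1
  rw [← lintegral_add_compl (μ := uniform 2) _ hm]
  congr 1
  · refine Eq.trans ?_ (setLIntegral_congr_fun (f := fun _ => 1) hm fun x hx => (if_pos hx).symm)
    rw [setLIntegral_const, one_mul]
  · exact (setLIntegral_congr_fun hm.compl fun x hx => if_neg hx).symm

theorem isBayesRule_bayesRule {h : E 2 → ℝ} (hh : Measurable h)
    (hint : ∫⁻ x, ENNReal.ofReal (h x) ∂(uniform 2) = 1) :
    IsBayesRule (classLaw h) (bayesRule h) := by
  have := isProbabilityMeasure_classLaw hint
  refine ⟨⟨measurable_bayesRule hh, bayesRule_eq h⟩, fun δ' hδ' => ?_⟩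
  refine ENNReal.toReal_mono (measure_ne_top _ _) ?_
  rw [classLaw_error ⟨measurable_bayesRule hh, bayesRule_eq h⟩, classLaw_error hδ']
  gcongr with x
  by_cases hx : 1 < h x
  · have h1 : (1 : ENNReal) ≤ ENNReal.ofReal (h x) := ENNReal.one_le_ofReal.2 hx.le
    simp only [bayesRule, if_pos hx, if_true]
    split_ifs
    exacts [le_rfl, h1]
  · have h1 : ENNReal.ofReal (h x) ≤ 1 := ENNReal.ofReal_le_one.2 (not_lt.1 hx)
    simp only [bayesRule, if_neg hx]
    split_ifs <;> first | exact h1 | exact le_rfl | omega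

/-- The vote of one observation in `B`, scaled so that its mean is the average of `h - 1`
over `B`. -/
def voteStat (B : Set (E 2)) (z : E 2 × ℕ) : ℝ :=
  2 / (uniform 2).real B * ({z : E 2 × ℕ | z.1 ∈ B ∧ z.2 = 1}.indicator 1 z -
    {z : E 2 × ℕ | z.1 ∈ B ∧ z.2 = 2}.indicator 1 z)

theorem measurableSet_vote {B : Set (E 2)} (hB : MeasurableSet B) (c : ℕ) :
    MeasurableSet {z : E 2 × ℕ | z.1 ∈ B ∧ z.2 = c} :=
  (measurable_fst hB).inter (measurable_snd (measurableSet_singleton c))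

theorem measurable_voteStat {B : Set (E 2)} (hB : MeasurableSet B) : Measurable (voteStat B) :=
  ((measurable_one.indicator (measurableSet_vote hB 1)).sub
    (measurable_one.indicator (measurableSet_vote hB 2))).const_mul _

theorem integrable_voteStat {ν : Measure (E 2 × ℕ)} [IsFiniteMeasure ν] {B : Set (E 2)}
    (hB : MeasurableSet B) : Integrable (voteStat B) ν :=
  (((integrable_const (1 : ℝ)).indicator (measurableSet_vote hB 1)).sub
    ((integrable_const (1 : ℝ)).indicator (measurableSet_vote hB 2))).const_mul _

theorem integral_voteStat {h : E 2 → ℝ} (hh : Integrable h (uniform 2)) (h0 : ∀ x, 0 ≤ h x)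
    [IsProbabilityMeasure (classLaw h)] {B : Set (E 2)}
    (hB : MeasurableSet B) (hpos : 0 < (uniform 2).real B) :
    ∫ z, voteStat B z ∂(classLaw h) =
      (∫ x in B, h x ∂(uniform 2)) / (uniform 2).real B - 1 := by
  have e1 : (classLaw h).real {z : E 2 × ℕ | z.1 ∈ B ∧ z.2 = 1} =
      2⁻¹ * ∫ x in B, h x ∂(uniform 2) := by
    rw [Measure.real, classLaw_apply (measurableSet_vote hB 1),
      integral_eq_lintegral_of_nonneg_ae (ae_of_all _ h0) hh.aestronglyMeasurable.restrict]
    simp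
  have e2 : (classLaw h).real {z : E 2 × ℕ | z.1 ∈ B ∧ z.2 = 2} = 2⁻¹ * (uniform 2).real B := by
    rw [Measure.real, classLaw_apply (measurableSet_vote hB 2)]
    simp [Measure.real]
  unfold voteStat
  rw [integral_const_mul, integral_sub, integral_indicator_one (measurableSet_vote hB 1),
    integral_indicator_one (measurableSet_vote hB 2), e1, e2]
  · field_simp
  · exact (integrable_const (1 : ℝ)).indicator (measurableSet_vote hB 1)
  · exact (integrable_const (1 : ℝ)).indicator (measurableSet_vote hB 2)

theorem sum_voteStat (B : Set (E 2)) (N : ℕ) (z : ℕ → E 2 × ℕ) [DecidablePred (· ∈ B)] :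
    ∑ n ∈ Finset.Icc 1 N, voteStat B (z n) = 2 / (uniform 2).real B *
      ((((Finset.Icc 1 N).filter fun n => (z n).1 ∈ B ∧ (z n).2 = 1).card : ℝ) -
        ((Finset.Icc 1 N).filter fun n => (z n).1 ∈ B ∧ (z n).2 = 2).card) := by
  classical
  simp only [voteStat, ← Finset.mul_sum, Finset.sum_sub_distrib, Finset.card_filter,
    Set.indicator_apply, Set.mem_ofPred_eq, Pi.one_apply]
  push_cast
  congr!

theorem majorityVote_eq_ite {Q : Set (Set (E 2))} {N : ℕ} {z : ℕ → E 2 × ℕ} {x : E 2}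
    (hpos : 0 < (uniform 2).real (cell Q x)) (hN : 0 < N) :
    majorityVote Q N z x =
      open Classical in
      if 0 < (∑ n ∈ Finset.Icc 1 N, voteStat (cell Q x) (z n)) / N then 1 else 2 := by
  classical
  have hN' : (0 : ℝ) < N := by exact_mod_cast hN
  rw [majorityVote, sum_voteStat]
  refine if_congr ?_ rfl rfl
  rw [div_pos_iff_of_pos_right hN', mul_pos_iff_of_pos_left (by positivity), sub_pos, Nat.cast_lt]

/-! ### The regression function -/

theorem exists_regression_function {δ : ℝ} (hδ : 0 < δ) :
    ∃ (R : ℕ → ℕ × ℕ) (g : E 2 → ℝ),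
      (∀ k, 0 < (R k).1 ∧ 0 < (R k).2) ∧
      Tendsto (fun k => (R k).1) atTop atTop ∧ Tendsto (fun k => (R k).2) atTop atTop ∧
      Measurable g ∧ (∀ x, 0 ≤ g x) ∧ Integrable g (uniform 2) ∧
      1 < ∫ x, g x ∂(uniform 2) ∧ ∫ x, g x ∂(uniform 2) ≤ 1 + δ ∧
      (∀ᵐ x ∂(uniform 2), g x = 1 ∨ 2 ≤ g x) ∧
      ∀ᵐ x ∂(uniform 2), ∀ M : ℕ, ∃ᶠ k in atTop, (M : ℝ) ≤ gridAverage g (R k) x := by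
  obtain ⟨R, F, hR, h1, h2, hF, hF01, hFint, hdiv⟩ := exists_divergent_grids hδ
  have htop : ∫⁻ x, (1 + F x) ∂(uniform 2) = 1 + ∫⁻ x, F x ∂(uniform 2) := by
    rw [lintegral_add_left measurable_const, lintegral_one, measure_univ]
  have hFfin : ∫⁻ x, F x ∂(uniform 2) ≠ ⊤ := ne_top_of_le_ne_top ENNReal.ofReal_ne_top hFint
  have hne : ∫⁻ x, (1 + F x) ∂(uniform 2) ≠ ⊤ := by
    rw [htop]
    exact ENNReal.add_ne_top.2 ⟨ENNReal.one_ne_top, hFfin⟩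
  have hm : Measurable fun x => 1 + F x := measurable_const.add hF
  have hlt : ∀ᵐ x ∂(uniform 2), 1 + F x < ⊤ := ae_lt_top hm hne
  have hI : ∫ x, (1 + F x).toReal ∂(uniform 2) = 1 + (∫⁻ x, F x ∂(uniform 2)).toReal := by
    rw [integral_toReal hm.aemeasurable hlt, htop, ENNReal.toReal_add ENNReal.one_ne_top hFfin,
      ENNReal.toReal_one]
  refine ⟨R, fun x => (1 + F x).toReal, hR, h1, h2, hm.ennreal_toReal,
    fun x => ENNReal.toReal_nonneg, integrable_toReal_of_lintegral_ne_top hm.aemeasurable hne,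
    ?_, ?_, ?_, ?_⟩
  · rw [hI, lt_add_iff_pos_right]
    -- If `F` had integral zero, no cell could have average at least `1`.
    refine ENNReal.toReal_pos (fun h0 => ?_) hFfin
    obtain ⟨x, hx, hxc⟩ := (hdiv.and ae_mem_cube).exists
    obtain ⟨k, hk⟩ := (hx 1).exists
    have hle := hk.trans (setLIntegral_le_lintegral _ _)
    rw [h0, Nat.cast_one, one_mul] at hle
    exact (uniform_gridCell_pos (gridIndex_mem_gridPositions (hR k) hxc)).not_ge hle
  · rw [hI]
    gcongr
    exact ENNReal.toReal_le_of_le_ofReal hδ.le hFint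
  · filter_upwards [hlt] with x hx
    rcases hF01 x with h | h
    · left
      simp [h]
    · right
      have : (2 : ENNReal) ≤ 1 + F x := by
        rw [← one_add_one_eq_two]
        gcongr
      simpa using ENNReal.toReal_mono hx.ne this
  · filter_upwards [hdiv, ae_mem_cube] with x hx hxc M
    refine (hx M).mono fun k hk => ?_
    have hpos := uniform_real_gridCell_pos (gridIndex_mem_gridPositions (hR k) hxc)
    rw [gridAverage, le_div_iff₀ hpos, integral_toReal hm.aemeasurable (ae_restrict_of_ae hlt)]
    have hle := hk.trans (lintegral_mono fun y => (le_add_self : F y ≤ 1 + F y))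
    have := ENNReal.toReal_mono (ne_top_of_le_ne_top hne (setLIntegral_le_lintegral _ _)) hle
    simpa [Measure.real] using this

/-! ### Slowly growing grids -/

/-- Summing the deviations over the finite index set gives one exceptional set and one time per `k`,
valid for all cells at once. A cell chosen by the random test point is thus covered too. -/
theorem exists_uniform_times_finset {α ι : Type*} [MeasurableSpace α] (μ : Measure α)
    [IsFiniteMeasure μ] (A : ℕ → Finset ι) (D : ℕ → ι → ℕ → α → ℝ) (c : ℕ → ι → ℝ)
    (hD : ∀ k i N, Measurable (D k i N))
    (hlim : ∀ k, ∀ i ∈ A k, ∀ᵐ z ∂μ, Tendsto (fun N => D k i N z) atTop (𝓝 (c k i))) :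
    ∃ (T : ℕ → ℕ) (t : ℕ → Set α), (∀ k, MeasurableSet (t k)) ∧
      (∀ k, μ (t k) ≤ ENNReal.ofReal (1 / 2 / 2 ^ k)) ∧
      ∀ k, ∀ z ∉ t k, ∀ N, T k ≤ N → ∀ i ∈ A k, |D k i N z - c k i| < 1 / ((k : ℝ) + 1) := by
  obtain ⟨T, t, h1, h2, h3⟩ := exists_uniform_times μ
    (fun k N z => ∑ i ∈ A k, |D k i N z - c k i|)
    (fun k N => Finset.measurable_sum _ fun i _ => ((hD k i N).sub_const _).abs) (fun k => by
      have : ∀ᵐ z ∂μ, ∀ i ∈ A k, Tendsto (fun N => D k i N z) atTop (𝓝 (c k i)) :=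
        (Finset.eventually_all (A k)).2 (hlim k)
      filter_upwards [this] with z hz
      rw [← Finset.sum_const_zero (s := A k)]
      refine tendsto_finsetSum _ fun i hi => ?_
      simpa using ((hz i hi).sub_const (c k i)).abs)
  refine ⟨T, t, h1, h2, fun k z hz N hN i hi => lt_of_le_of_lt ?_ (h3 k z hz N hN)⟩
  exact (Finset.single_le_sum (f := fun i => |D k i N z - c k i|) (fun _ _ => abs_nonneg _)
    hi).trans (le_abs_self _)

theorem frequently_comp_of_slow {κ : ℕ → ℕ} (hκ : ∀ k, ∃ N, k ≤ N ∧ κ N = k) {p : ℕ → Prop}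
    (hp : ∃ᶠ k in atTop, p k) : ∃ᶠ N in atTop, p (κ N) := by
  rw [frequently_atTop] at hp ⊢
  intro N₀
  obtain ⟨k, hk, hpk⟩ := hp N₀
  obtain ⟨N, hN, rfl⟩ := hκ k
  exact ⟨N, hk.trans hN, hpk⟩

theorem IsIID.ae_eventually_notMem {Ω S : Type*} [MeasurableSpace Ω] [MeasurableSpace S]
    {P : Measure Ω} [IsProbabilityMeasure P] {ν : Measure S} {Z : ℕ → Ω → S} (h : IsIID P ν Z)
    {t : ℕ → Set (ℕ → S)} (ht : ∀ k, MeasurableSet (t k))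
    (hμ : ∀ k, Measure.infinitePi (fun _ => ν) (t k) ≤ ENNReal.ofReal (1 / 2 / 2 ^ k)) :
    ∀ᵐ ω ∂P, ∀ᶠ k in atTop, (fun n => Z n ω) ∉ t k := by
  refine MeasureTheory.ae_eventually_notMem (s := fun k => {ω | (fun n => Z n ω) ∈ t k}) ?_
  simp only [h.measure_preimage (ht _)]
  exact ne_top_of_le_ne_top tsum_half_geometric_ne_top (ENNReal.tsum_le_tsum hμ)

theorem IsIID.ae_of_ae {Ω S : Type*} [MeasurableSpace Ω] [MeasurableSpace S] {P : Measure Ω}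
    {ν : Measure S} {Z : ℕ → Ω → S} (h : IsIID P ν Z) (n : ℕ) {p : S → Prop}
    (hp : ∀ᵐ z ∂ν, p z) : ∀ᵐ ω ∂P, p (Z n ω) :=
  ae_of_ae_map (h.measurable n).aemeasurable (by rwa [h.law n])

theorem IsIID.measure_mem {Ω S : Type*} [MeasurableSpace Ω] [MeasurableSpace S] {P : Measure Ω}
    {ν : Measure S} {Z : ℕ → Ω → S} (h : IsIID P ν Z) (n : ℕ) {s : Set S}
    (hs : MeasurableSet s) : P {ω | Z n ω ∈ s} = ν s := by
  rw [← h.law n, Measure.map_apply (h.measurable n) hs]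
  rfl

/-! ### Regression along slowly growing grids -/

theorem tendsto_empiricalCellMean_sub {ν : Measure (E 2 × ℝ)} (hν : ν.map Prod.fst = uniform 2)
    {R : ℕ → ℕ × ℕ} (hR : ∀ k, 0 < (R k).1 ∧ 0 < (R k).2) {T : ℕ → ℕ}
    {t : ℕ → Set (ℕ → E 2 × ℝ)} (ht : ∀ k, MeasurableSet (t k))
    (hμ : ∀ k, Measure.infinitePi (fun _ => ν) (t k) ≤ ENNReal.ofReal (1 / 2 / 2 ^ k))
    (hT : ∀ k, ∀ z ∉ t k, ∀ N, T k ≤ N → ∀ a ∈ gridPositions (R k),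
      |sampleMean (gridCell (R k) a) N z - meanOn ν (gridCell (R k) a)| < 1 / ((k : ℝ) + 1))
    {κ : ℕ → ℕ} (hκ : Tendsto κ atTop atTop) (hκT : ∀ᶠ N in atTop, T (κ N) ≤ N)
    {Ω : Type*} [MeasurableSpace Ω] {P : Measure Ω} [IsProbabilityMeasure P]
    {Z : ℕ → Ω → E 2 × ℝ} (hZ : IsIID P ν Z) :
    ∀ᵐ ω ∂P, Tendsto (fun N => empiricalCellMean (gridPartition (R (κ N))) N (fun n => Z n ω)
      (Z 0 ω).1 - cellMean ν (gridPartition (R (κ N))) (Z 0 ω).1) atTop (𝓝 0) := by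
  have hcube : ∀ᵐ z ∂ν, z.1 ∈ cube 2 :=
    ae_of_ae_map measurable_fst.aemeasurable (by rw [hν]; exact ae_mem_cube)
  filter_upwards [hZ.ae_eventually_notMem ht hμ, hZ.ae_of_ae 0 hcube] with ω hω hx
  refine squeeze_zero_norm' ?_ (tendsto_one_div_add_atTop_nhds_zero_nat.comp hκ)
  filter_upwards [hκ.eventually hω, hκT] with N hN hTN
  rw [empiricalCellMean_eq_sampleMean, cellMean_eq_meanOn, cell_gridPartition (hR _) hx]
  exact (hT _ _ hN N hTN _ (gridIndex_mem_gridPositions (hR _) hx)).le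

/-- For this noiseless law the cell means are grid averages of `g`, which exceed `g x + 1`
infinitely often; the schedule visits every grid, so the excess recurs along `N`. -/
theorem measure_tendsto_cellMean_sub_eq_zero {g : E 2 → ℝ} (hg : Measurable g)
    {R : ℕ → ℕ × ℕ} (hR : ∀ k, 0 < (R k).1 ∧ 0 < (R k).2)
    (hdiv : ∀ᵐ x ∂(uniform 2), ∀ M : ℕ, ∃ᶠ k in atTop, (M : ℝ) ≤ gridAverage g (R k) x)
    {κ : ℕ → ℕ} (hκ : ∀ k, ∃ N, k ≤ N ∧ κ N = k)
    {Ω : Type*} [MeasurableSpace Ω] {P : Measure Ω}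
    {Z : ℕ → Ω → E 2 × ℝ} (hZ : IsIID P (graphLaw g) Z) :
    P {ω | Tendsto (fun N => cellMean (graphLaw g) (gridPartition (R (κ N))) (Z 0 ω).1 -
      g (Z 0 ω).1) atTop (𝓝 0)} = 0 := by
  have hae : ∀ᵐ z ∂(graphLaw g), z.1 ∈ cube 2 ∧
      ∀ M : ℕ, ∃ᶠ k in atTop, (M : ℝ) ≤ gridAverage g (R k) z.1 := by
    refine ae_of_ae_map measurable_fst.aemeasurable
      (p := fun x => x ∈ cube 2 ∧ ∀ M : ℕ, ∃ᶠ k in atTop, (M : ℝ) ≤ gridAverage g (R k) x) ?_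
    rw [map_fst_graphLaw hg]
    exact ae_mem_cube.and hdiv
  refine (measure_eq_zero_iff_ae_notMem).2 ?_
  filter_upwards [hZ.ae_of_ae 0 hae] with ω hω htend
  obtain ⟨M, hM⟩ := exists_nat_ge (g (Z 0 ω).1 + 1)
  have h1 := frequently_comp_of_slow hκ (hω.2 M)
  obtain ⟨N, hN, hN'⟩ := (h1.and_eventually (htend.eventually_lt_const one_pos)).exists
  rw [cellMean_eq_meanOn, cell_gridPartition (hR _) hω.1, meanOn_graphLaw hg] at hN'
  linarith

/-! ### Majority votes along slowly growing grids -/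

/-- The marginal law of `X` is absolutely continuous with respect to the uniform law. -/
theorem ae_classLaw_of_ae {h : E 2 → ℝ} {p : E 2 → Prop} (hp : ∀ᵐ x ∂(uniform 2), p x) :
    ∀ᵐ z ∂(classLaw h), p z.1 := by
  have hac : (classLaw h).map Prod.fst ≪ uniform 2 := by
    refine Measure.AbsolutelyContinuous.mk fun s hs h0 => ?_
    rw [Measure.map_apply measurable_fst hs]
    exact (classLaw_fst_mem h hs).trans (by rw [setLIntegral_measure_zero s _ h0, h0]; simp)
  exact ae_of_ae_map measurable_fst.aemeasurable (hac.ae_le hp)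

theorem tendsto_classLaw_fst_mem {h : E 2 → ℝ}
    (hint : ∫⁻ x, ENNReal.ofReal (h x) ∂(uniform 2) = 1) {s : ℕ → Set (E 2)}
    (hs : ∀ N, MeasurableSet (s N)) (h0 : Tendsto (fun N => uniform 2 (s N)) atTop (𝓝 0)) :
    Tendsto (fun N => classLaw h {z | z.1 ∈ s N}) atTop (𝓝 0) := by
  have h1 := tendsto_setLIntegral_zero (μ := uniform 2) (f := fun x => ENNReal.ofReal (h x))
    (by rw [hint]; exact ENNReal.one_ne_top) (s := s) h0
  have h2 := (ENNReal.Tendsto.const_mul (a := 2⁻¹) h1 (by simp)).add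
    (ENNReal.Tendsto.const_mul (a := 2⁻¹) h0 (by simp))
  simp only [classLaw_fst_mem h (hs _)]
  simpa using h2

/-- Off the exceptional set the vote in every cell is close to the average of `h - 1`. -/
theorem majorityVote_spec {h : E 2 → ℝ} {s : ℕ × ℕ} (hs : 0 < s.1 ∧ 0 < s.2) {N : ℕ}
    (hN : 0 < N) {z : ℕ → E 2 × ℕ} {c : ℝ}
    (hz : ∀ a ∈ gridPositions s, |(∑ n ∈ Finset.Icc 1 N, voteStat (gridCell s a) (z n)) / N -
      ((∫ y in gridCell s a, h y ∂(uniform 2)) / (uniform 2).real (gridCell s a) - 1)| < c)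
    {x : E 2} (hx : x ∈ cube 2) :
    (c ≤ gridAverage h s x - 1 → majorityVote (gridPartition s) N z x = 1) ∧
    (gridAverage h s x - 1 ≤ -c → majorityVote (gridPartition s) N z x = 2) := by
  have ha := gridIndex_mem_gridPositions hs hx
  have h1 := abs_lt.1 (hz _ ha)
  rw [majorityVote_eq_ite _ hN, cell_gridPartition hs hx]
  · simp only [gridAverage]
    constructor <;> intro h2
    · exact if_pos (by linarith)
    · exact if_neg (by linarith)
  · rw [cell_gridPartition hs hx]
    exact uniform_real_gridCell_pos ha

/-- Majority votes along slowly growing grids are Bayes-risk consistent if the density stays away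
from one. -/
theorem tendsto_risk_majorityVote {h : E 2 → ℝ} (hh : Measurable h)
    (hhint : Integrable h (uniform 2)) (hint : ∫⁻ x, ENNReal.ofReal (h x) ∂(uniform 2) = 1)
    {c : ℝ} (hc : 0 < c) (hgap : ∀ᵐ x ∂(uniform 2), c ≤ |h x - 1|)
    {R : ℕ → ℕ × ℕ} (hR : ∀ k, 0 < (R k).1 ∧ 0 < (R k).2)
    (hR1 : Tendsto (fun k => (R k).1) atTop atTop) (hR2 : Tendsto (fun k => (R k).2) atTop atTop)
    {T : ℕ → ℕ} {t : ℕ → Set (ℕ → E 2 × ℕ)} (ht : ∀ k, MeasurableSet (t k))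
    (hμ : ∀ k, Measure.infinitePi (fun _ => classLaw h) (t k) ≤ ENNReal.ofReal (1 / 2 / 2 ^ k))
    (hT : ∀ k, ∀ z ∉ t k, ∀ N, T k ≤ N → ∀ a ∈ gridPositions (R k),
      |(∑ n ∈ Finset.Icc 1 N, voteStat (gridCell (R k) a) (z n)) / N -
        ((∫ y in gridCell (R k) a, h y ∂(uniform 2)) / (uniform 2).real (gridCell (R k) a) - 1)| <
          1 / ((k : ℝ) + 1))
    {κ : ℕ → ℕ} (hκ : Tendsto κ atTop atTop) (hκT : ∀ᶠ N in atTop, T (κ N) ≤ N)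
    {Ω : Type*} [MeasurableSpace Ω] {P : Measure Ω} [IsProbabilityMeasure P]
    {Z : ℕ → Ω → E 2 × ℕ} (hZ : IsIID P (classLaw h) Z) :
    Tendsto (fun N => P.real {ω | majorityVote (gridPartition (R (κ N))) N (fun n => Z n ω)
      (Z 0 ω).1 ≠ (Z 0 ω).2}) atTop (𝓝 (risk (classLaw h) (bayesRule h))) := by
  let G : ℕ → Set (E 2) := fun N => {x | c / 2 ≤ |gridAverage h (R (κ N)) x - h x|}
  have hG : ∀ N, MeasurableSet (G N) := fun N =>
    measurableSet_le measurable_const ((measurable_gridAverage _ _).sub hh).abs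
  have hG0 : Tendsto (fun N => classLaw h {z | z.1 ∈ G N}) atTop (𝓝 0) :=
    tendsto_classLaw_fst_mem hint hG (tendsto_measure_gridAverage_sub hhint (fun N => hR (κ N))
      (hR1.comp hκ) (hR2.comp hκ) (half_pos hc))
  -- Off `bad N` the vote differs from the average of `h - 1` by less than `c / 2` for large `N`,
  -- and that average from `h - 1` by less than `c / 2`; as `|h - 1| ≥ c`, the signs agree.
  let bad : ℕ → Set Ω := fun N => {ω | (fun n => Z n ω) ∈ t (κ N)} ∪ {ω | (Z 0 ω).1 ∈ G N}
  have hbad : Tendsto (fun N => P.real (bad N)) atTop (𝓝 0) := by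
    rw [← ENNReal.toReal_zero]
    refine (ENNReal.tendsto_toReal ENNReal.zero_ne_top).comp ?_
    refine tendsto_of_tendsto_of_tendsto_of_le_of_le tendsto_const_nhds (h := fun N =>
      ENNReal.ofReal (1 / 2 / 2 ^ κ N) + classLaw h {z | z.1 ∈ G N}) ?_ (fun _ => zero_le) ?_
    · simpa using (tendsto_half_geometric.comp hκ).add hG0
    · intro N
      refine (measure_union_le _ _).trans (add_le_add ?_ ?_)
      · rw [hZ.measure_preimage (ht _)]
        exact hμ _
      · exact (hZ.measure_mem 0 (measurableSet_fst_mem (hG N))).le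
  have hae : ∀ᵐ ω ∂P, (Z 0 ω).1 ∈ cube 2 ∧ c ≤ |h (Z 0 ω).1 - 1| :=
    hZ.ae_of_ae 0 (p := fun z => z.1 ∈ cube 2 ∧ c ≤ |h z.1 - 1|)
      (ae_classLaw_of_ae (ae_mem_cube.and hgap))
  have hagree : ∀ᶠ N in atTop, ∀ᵐ ω ∂P, ω ∉ bad N →
      majorityVote (gridPartition (R (κ N))) N (fun n => Z n ω) (Z 0 ω).1 =
        bayesRule h (Z 0 ω).1 := by
    have hsmall := (tendsto_one_div_add_atTop_nhds_zero_nat (𝕜 := ℝ)).comp hκ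
    filter_upwards [hκT, eventually_gt_atTop 0, hsmall.eventually_lt_const (half_pos hc)]
      with N hTN hN hNc
    filter_upwards [hae] with ω hω hωbad
    simp only [bad, G, Set.mem_union, Set.mem_ofPred_eq, not_or, not_le] at hωbad
    have hspec := majorityVote_spec (hR (κ N)) hN (hT _ _ hωbad.1 N hTN) hω.1
    have hclose := abs_lt.1 hωbad.2
    simp only [Function.comp_apply] at hNc
    rcases le_abs.1 hω.2 with h1 | h1
    · rw [hspec.1 (by linarith), bayesRule, if_pos (by linarith)]
    · rw [hspec.2 (by linarith), bayesRule, if_neg (by linarith)]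
  have hrisk : risk (classLaw h) (bayesRule h) =
      P.real {ω | bayesRule h (Z 0 ω).1 ≠ (Z 0 ω).2} :=
    congrArg ENNReal.toReal
      (hZ.measure_mem 0 (measurableSet_error (measurable_bayesRule hh))).symm
  rw [hrisk, tendsto_iff_norm_sub_tendsto_zero]
  refine squeeze_zero' (Eventually.of_forall fun _ => norm_nonneg _) ?_ hbad
  filter_upwards [hagree] with N hN
  -- Used in both directions: two rules agreeing off `bad N` have error probabilities differing by
  -- at most its probability.
  have key : ∀ u v : Ω → ℕ, (∀ᵐ ω ∂P, ω ∉ bad N → u ω = v ω) →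
      P.real {ω | u ω ≠ (Z 0 ω).2} ≤ P.real {ω | v ω ≠ (Z 0 ω).2} + P.real (bad N) := by
    intro u v huv
    refine le_trans ?_ (measureReal_union_le _ _)
    refine ENNReal.toReal_mono (measure_ne_top _ _) (measure_mono_ae ?_)
    filter_upwards [huv] with ω hω hu
    by_cases hb : ω ∈ bad N
    · exact Or.inr hb
    · exact Or.inl fun h => hu ((hω hb).trans h)
  have k1 := key _ _ hN
  have k2 := key _ _ (hN.mono fun ω hω hb => (hω hb).symm)
  rw [Real.norm_eq_abs, abs_le]
  constructor <;> linarith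

/-- Majority votes along slowly growing grids converge to class `2` almost nowhere if the density
has unbounded averages almost everywhere. -/
theorem ae_not_tendsto_majorityVote_two {h : E 2 → ℝ}
    {R : ℕ → ℕ × ℕ} (hR : ∀ k, 0 < (R k).1 ∧ 0 < (R k).2)
    (hdiv : ∀ᵐ x ∂(uniform 2), ∃ᶠ k in atTop, 2 ≤ gridAverage h (R k) x)
    {T : ℕ → ℕ} {t : ℕ → Set (ℕ → E 2 × ℕ)} (ht : ∀ k, MeasurableSet (t k))
    (hμ : ∀ k, Measure.infinitePi (fun _ => classLaw h) (t k) ≤ ENNReal.ofReal (1 / 2 / 2 ^ k))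
    (hT : ∀ k, ∀ z ∉ t k, ∀ N, T k ≤ N → ∀ a ∈ gridPositions (R k),
      |(∑ n ∈ Finset.Icc 1 N, voteStat (gridCell (R k) a) (z n)) / N -
        ((∫ y in gridCell (R k) a, h y ∂(uniform 2)) / (uniform 2).real (gridCell (R k) a) - 1)| <
          1 / ((k : ℝ) + 1))
    {κ : ℕ → ℕ} (hκ : Tendsto κ atTop atTop) (hκT : ∀ᶠ N in atTop, T (κ N) ≤ N)
    (hsurj : ∀ k, ∃ N, k ≤ N ∧ κ N = k)
    {Ω : Type*} [MeasurableSpace Ω] {P : Measure Ω} [IsProbabilityMeasure P]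
    {Z : ℕ → Ω → E 2 × ℕ} (hZ : IsIID P (classLaw h) Z) :
    ∀ᵐ ω ∂P, ¬ Tendsto (fun N => majorityVote (gridPartition (R (κ N))) N (fun n => Z n ω)
      (Z 0 ω).1) atTop (𝓝 2) := by
  have hae : ∀ᵐ ω ∂P, (Z 0 ω).1 ∈ cube 2 ∧
      ∃ᶠ k in atTop, 2 ≤ gridAverage h (R k) (Z 0 ω).1 :=
    hZ.ae_of_ae 0 (p := fun z => z.1 ∈ cube 2 ∧ ∃ᶠ k in atTop, 2 ≤ gridAverage h (R k) z.1)
      (ae_classLaw_of_ae (ae_mem_cube.and hdiv))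
  filter_upwards [hae, hZ.ae_eventually_notMem ht hμ] with ω hω hgood htend
  rw [nhds_discrete, tendsto_pure] at htend
  obtain ⟨N, hN2, ⟨⟨hvote, hNt⟩, hTN⟩, hN⟩ :=
    ((frequently_comp_of_slow hsurj hω.2).and_eventually
      (((htend.and (hκ.eventually hgood)).and hκT).and (eventually_gt_atTop 0))).exists
  have hspec := majorityVote_spec (hR (κ N)) hN (hT _ _ hNt N hTN) hω.1
  -- An average of at least `2` exceeds `1` by at least the tolerance, so the vote is `1`,
  -- contradicting eventual vote `2`.
  have hone : 1 / ((κ N : ℝ) + 1) ≤ 1 :=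
    (div_le_one (by positivity)).2 (le_add_of_nonneg_left (Nat.cast_nonneg _))
  have := hspec.1 (by linarith)
  omega

end TreeRules

end

/-! ### Assembly: one sequence of grids for both problems -/

theorem corollary1p4 (ε : ℝ) (hε : 0 < ε) :
    ∃ (Q : ℕ → Set (Set (TreeRules.E 2))) (ν : Measure (TreeRules.E 2 × ℝ))
      (g : TreeRules.E 2 → ℝ),
      -- finite, rooted, binary tree-structured partitions of the unit square, with norms tending to 0
      (∀ N, TreeRules.IsTreePartition (TreeRules.cube 2) (Q N)) ∧
      (∀ N, ∀ B ∈ Q N, 0 < volume B) ∧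
      Tendsto (fun N => TreeRules.partitionNorm (Q N)) atTop (𝓝 0) ∧
      -- the regression problem
      TreeRules.IsRegressionModel ν g ∧
      0 < ∫ x, g x ∂(TreeRules.uniform 2) ∧
      (∀ (Ω : Type*) [MeasurableSpace Ω] (P : Measure Ω) [IsProbabilityMeasure P]
        (Z : ℕ → Ω → TreeRules.E 2 × ℝ), TreeRules.IsIID P ν Z →
        (∀ᵐ ω ∂P, Tendsto
          (fun N => TreeRules.empiricalCellMean (Q N) N (fun n => Z n ω) (Z 0 ω).1 -
            TreeRules.cellMean ν (Q N) (Z 0 ω).1) atTop (𝓝 0)) ∧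
        P {ω | Tendsto
          (fun N => TreeRules.cellMean ν (Q N) (Z 0 ω).1 - g (Z 0 ω).1) atTop (𝓝 0)} = 0) ∧
      -- the two-class problem, with `h = scaledDensity g`
      TreeRules.IsBayesRule (TreeRules.classLaw (TreeRules.scaledDensity g))
        (TreeRules.bayesRule (TreeRules.scaledDensity g)) ∧
      (∀ (Ω : Type*) [MeasurableSpace Ω] (P : Measure Ω) [IsProbabilityMeasure P]
        (Z : ℕ → Ω → TreeRules.E 2 × ℕ),
        TreeRules.IsIID P (TreeRules.classLaw (TreeRules.scaledDensity g)) Z →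
        Tendsto
          (fun N => P.real
            {ω | TreeRules.majorityVote (Q N) N (fun n => Z n ω) (Z 0 ω).1 ≠ (Z 0 ω).2})
          atTop (𝓝 (TreeRules.risk (TreeRules.classLaw (TreeRules.scaledDensity g))
            (TreeRules.bayesRule (TreeRules.scaledDensity g)))) ∧
        P.real {ω | Tendsto
          (fun N => TreeRules.majorityVote (Q N) N (fun n => Z n ω) (Z 0 ω).1)
          atTop (𝓝 (TreeRules.bayesRule (TreeRules.scaledDensity g) (Z 0 ω).1))} < ε) := by
  open TreeRules in
  -- `δ < 1` keeps `∫ g` below `2`, so that `g ≥ 2` implies `h > 1`; `3 / 2 * δ` will bound the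
  -- probability of `{g ≥ 2}`.
  obtain ⟨δ, hδ, hδ1, hδε⟩ : ∃ δ : ℝ, 0 < δ ∧ δ < 1 ∧ 3 / 2 * δ < ε :=
    ⟨min (1 / 2) (ε / 2), by positivity, (min_le_left _ _).trans_lt (by norm_num),
      by linarith [min_le_right (1 / 2) (ε / 2)]⟩
  obtain ⟨R, g, hR, hR1, hR2, hg, hg0, hgint, hI1, hI2, hg12, hdiv⟩ :=
    exists_regression_function hδ
  set I := ∫ x, g x ∂(uniform 2) with hI
  have hIpos : 0 < I := one_pos.trans hI1
  set h := scaledDensity g with hhdef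
  have hh : Measurable h := hg.div_const _
  have hh0 : ∀ x, 0 ≤ h x := fun x => div_nonneg (hg0 x) hIpos.le
  have hhint : Integrable h (uniform 2) := hgint.div_const _
  have hone : ∫⁻ x, ENNReal.ofReal (h x) ∂(uniform 2) = 1 := by
    rw [← ofReal_integral_eq_lintegral_ofReal hhint (ae_of_all _ hh0), hhdef]
    simp only [scaledDensity]
    rw [integral_div, ← hI, div_self hIpos.ne', ENNReal.ofReal_one]
  have hprobν := isProbabilityMeasure_graphLaw hg
  have hprobc := isProbabilityMeasure_classLaw hone
  have hmodel := isRegressionModel_graphLaw hg hg0 hgint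
  obtain ⟨T₁, t₁, ht₁, hμ₁, hT₁⟩ := exists_uniform_times_finset
    (Measure.infinitePi fun _ : ℕ => graphLaw g) (fun k => gridPositions (R k))
    (fun k a N z => sampleMean (gridCell (R k) a) N z)
    (fun k a => meanOn (graphLaw g) (gridCell (R k) a))
    (fun k a N => measurable_sampleMean (measurableSet_gridCell _ _) N)
    (fun k a ha => ae_tendsto_sampleMean hmodel.integrable (measurableSet_gridCell _ _) (by
      rw [graphLaw_real_fst_mem hg (measurableSet_gridCell _ _)]
      exact uniform_real_gridCell_pos ha))
  obtain ⟨T₂, t₂, ht₂, hμ₂, hT₂⟩ := exists_uniform_times_finset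
    (Measure.infinitePi fun _ : ℕ => classLaw h) (fun k => gridPositions (R k))
    (fun k a N z => (∑ n ∈ Finset.Icc 1 N, voteStat (gridCell (R k) a) (z n)) / N)
    (fun k a => (∫ y in gridCell (R k) a, h y ∂(uniform 2)) /
      (uniform 2).real (gridCell (R k) a) - 1)
    (fun k a N => (Finset.measurable_sum _ fun n _ =>
      (measurable_voteStat (measurableSet_gridCell _ _)).comp (measurable_pi_apply n)).div_const _)
    (fun k a ha => by
      rw [← integral_voteStat hhint hh0 (measurableSet_gridCell _ _) (uniform_real_gridCell_pos ha)]
      exact ae_tendsto_sample_average (measurable_voteStat (measurableSet_gridCell _ _))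
        (integrable_voteStat (measurableSet_gridCell _ _)))
  -- The same partitions serve both problems, so the schedule must be slow enough for both laws.
  obtain ⟨κ, hκ, hκT, hsurj⟩ := exists_slow_schedule fun k => max (T₁ k) (T₂ k)
  have hκT₁ : ∀ᶠ N in atTop, T₁ (κ N) ≤ N := hκT.mono fun N hN => (le_max_left _ _).trans hN
  have hκT₂ : ∀ᶠ N in atTop, T₂ (κ N) ≤ N := hκT.mono fun N hN => (le_max_right _ _).trans hN
  refine ⟨fun N => gridPartition (R (κ N)), graphLaw g, g,
    fun N => isTreePartition_gridPartition (hR _), ?_, ?_, hmodel, hIpos, ?_,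
    isBayesRule_bayesRule hh hone, ?_⟩
  · rintro N _ ⟨a, ha, rfl⟩
    exact volume_gridCell_pos ha
  · have hmesh := ((tendsto_inv_atTop_nhds_zero_nat (𝕜 := ℝ)).comp (hR1.comp hκ)).add
      ((tendsto_inv_atTop_nhds_zero_nat (𝕜 := ℝ)).comp (hR2.comp hκ))
    rw [add_zero] at hmesh
    exact squeeze_zero (fun N => partitionNorm_nonneg _)
      (fun N => partitionNorm_gridPartition_le (hR _)) hmesh
  · intro Ω _ P _ Z hZ
    exact ⟨tendsto_empiricalCellMean_sub hmodel.uniform_fst hR ht₁ hμ₁ hT₁ hκ hκT₁ hZ,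
      measure_tendsto_cellMean_sub_eq_zero hg hR hdiv hsurj hZ⟩
  · intro Ω _ P _ Z hZ
    constructor
    -- The gap `c`: `h = 1 / I` where `g = 1`, and `h ≥ 2 / I` where `g ≥ 2`.
    · refine tendsto_risk_majorityVote hh hhint hone (c := min (1 - 1 / I) (2 / I - 1)) ?_ ?_ hR
        hR1 hR2 ht₂ hμ₂ hT₂ hκ hκT₂ hZ
      · refine lt_min (sub_pos.2 ((div_lt_one hIpos).2 hI1)) (sub_pos.2 ?_)
        rw [lt_div_iff₀ hIpos]
        linarith
      · filter_upwards [hg12] with x hx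
        rcases hx with hx | hx
        · refine (min_le_left _ _).trans (le_trans (le_of_eq ?_) (neg_le_abs _))
          simp only [hhdef, scaledDensity, hx, ← hI]
          ring
        · refine (min_le_right _ _).trans (le_trans ?_ (le_abs_self _))
          simp only [hhdef, scaledDensity, ← hI]
          gcongr
    · have hdivh : ∀ᵐ x ∂(uniform 2), ∃ᶠ k in atTop, 2 ≤ gridAverage h (R k) x := by
        filter_upwards [hdiv] with x hx
        -- Since `I < 2`, average `4` for `g` gives average at least `2` for `h`.
        refine (hx 4).mono fun k hk => ?_
        have : gridAverage h (R k) x = gridAverage g (R k) x / I := by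
          simp only [gridAverage, hhdef, scaledDensity, integral_div, ← hI]
          ring
        rw [this, le_div_iff₀ hIpos]
        push_cast at hk
        linarith
      have hA : MeasurableSet {x | 2 ≤ g x} := measurableSet_le measurable_const hg
      have hg1 : ∫⁻ x, ENNReal.ofReal (g x - 1) ∂(uniform 2) ≤ ENNReal.ofReal δ := by
        rw [← ofReal_integral_eq_lintegral_ofReal (f := fun x => g x - 1)
            (hgint.sub (integrable_const 1)),
          integral_sub hgint (integrable_const 1)]
        · refine ENNReal.ofReal_le_ofReal ?_
          simp only [integral_const, probReal_univ, smul_eq_mul, mul_one]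
          linarith
        · filter_upwards [hg12] with x hx
          rcases hx with hx | hx <;> simp only [Pi.zero_apply] <;> linarith
      -- On `{g ≥ 2}` both `1 ≤ g - 1` and `h ≤ g ≤ 2 * (g - 1)` hold, and `g - 1` has integral at
      -- most `δ`. The two classes thus contribute `δ` and `2 * δ`, each with weight `1 / 2`.
      have hAg : ∀ c : ℝ, 0 ≤ c → ∀ f : E 2 → ENNReal,
          (∀ x, 2 ≤ g x → f x ≤ ENNReal.ofReal (c * (g x - 1))) →
          ∫⁻ x in {x | 2 ≤ g x}, f x ∂(uniform 2) ≤ ENNReal.ofReal (c * δ) := by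
        intro c hc f hf
        calc ∫⁻ x in {x | 2 ≤ g x}, f x ∂(uniform 2)
            ≤ ∫⁻ x in {x | 2 ≤ g x}, ENNReal.ofReal c * ENNReal.ofReal (g x - 1) ∂(uniform 2) := by
              refine setLIntegral_mono (by fun_prop) fun x hx => ?_
              rw [← ENNReal.ofReal_mul hc]
              exact hf x hx
          _ ≤ ∫⁻ x, ENNReal.ofReal c * ENNReal.ofReal (g x - 1) ∂(uniform 2) :=
              setLIntegral_le_lintegral _ _
          _ = ENNReal.ofReal c * ∫⁻ x, ENNReal.ofReal (g x - 1) ∂(uniform 2) :=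
              lintegral_const_mul _ (by fun_prop)
          _ ≤ ENNReal.ofReal (c * δ) := by
              rw [ENNReal.ofReal_mul hc]
              gcongr
      have hsmall : P {ω | 2 ≤ g (Z 0 ω).1} ≤ ENNReal.ofReal (3 / 2 * δ) := by
        refine (hZ.measure_mem 0 (measurableSet_fst_mem hA)).trans_le ?_
        have b1 := hAg 2 (by norm_num) (fun x => ENNReal.ofReal (h x)) fun x hx => by
          refine ENNReal.ofReal_le_ofReal ?_
          calc h x ≤ g x := div_le_self (hg0 x) hI1.le
            _ ≤ 2 * (g x - 1) := by linarith
        have b2 := hAg 1 zero_le_one (fun _ => 1) fun x hx =>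
          ENNReal.one_le_ofReal.2 (by linarith)
        rw [setLIntegral_one] at b2
        rw [classLaw_fst_mem h hA, ← mul_add]
        calc (2⁻¹ : ENNReal) * (_ + _)
            ≤ 2⁻¹ * (ENNReal.ofReal (2 * δ) + ENNReal.ofReal (1 * δ)) := by gcongr
          _ = ENNReal.ofReal (3 / 2 * δ) := by
            rw [← ENNReal.ofReal_add (by positivity) (by positivity),
              show (2⁻¹ : ENNReal) = ENNReal.ofReal 2⁻¹ by
                rw [ENNReal.ofReal_inv_of_pos two_pos, ENNReal.ofReal_ofNat],
              ← ENNReal.ofReal_mul (by positivity)]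
            congr 1
            ring
      refine lt_of_le_of_lt ?_ hδε
      refine ENNReal.toReal_le_of_le_ofReal (by positivity) (le_trans (measure_mono_ae ?_) hsmall)
      -- Where `g = 1` the Bayes rule is `2`, a limit the votes almost surely do not have;
      -- convergence leaves only `g ≥ 2`.
      filter_upwards [ae_not_tendsto_majorityVote_two hR hdivh ht₂ hμ₂ hT₂ hκ hκT₂ hsurj hZ,
        hZ.ae_of_ae 0 (ae_classLaw_of_ae hg12)] with ω hω hgω htend
      rcases hgω with h1 | h1
      · refine absurd ?_ hω
        have : bayesRule h (Z 0 ω).1 = 2 := by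
          refine if_neg (not_lt.2 ?_)
          simp only [hhdef, scaledDensity, h1, ← hI]
          exact (div_le_one hIpos).2 hI1.le
        have htend' : Tendsto _ _ (𝓝 (bayesRule h (Z 0 ω).1)) := htend
        rwa [congrArg 𝓝 this] at htend'
      · exact h1
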